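/- Let $V_{\mathbb Q}$ be a finite-dimensional rational vector space with a quadratic form $q$ of signature $(3,d)$, $d\ge 2$, and let $V:=V_{\mathbb Q}\otimes_{\mathbb Q}\mathbb R$. A \emph{rational Lie subgroup} is the group of real points of an algebraic subgroup of $GL(V)$ defined over $\mathbb Q$ (with respect to $V_{\mathbb Q}$). For a subspace $U\subset V$ on which $q$ is nondegenerate, $SO(U)\subset SO(V)$ is the group of isometries of determinant $1$ acting trivially on $U^\perp$, and $SO^+(U)$ is its identity component. An element of a space $X$ of subspaces of a fixed dimension of a real vector space is called \emph{general} if it lies outside a certain countable union of Zariski closed subsets of $X$ of positive codimension. Let $V_1\subset V$ be a subspace of signature $(1,d)$ and $P\subset V_1$ a one-dimensional subspace. Let $W$ be a general element of the space of 3-dimensional subspaces of signature $(1,2)$ with $P\subset W\subset V_1$, and let $H_0=\{\exp(tN) : t\in\mathbb R\}$ (with $N\ne 0$ nilpotent) be a general one-parameter unipotent subgroup of $SO(W)$, these subgroups being parametrized by their Lie algebras, i.e. the lines $\mathbb R N\subset \mathrm{End}(V)$. Then the smallest rational Lie subgroup containing $H_0$ contains $SO^+(V_1)$. -/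

import Mathlib

open scoped TensorProduct

noncomputable section

namespace RationalHull

section Signature

/-- The restriction of the real quadratic form `Q` to the subspace `W` is nondegenerate of
signature `(p, q)`. -/
def HasSignature {V : Type*} [AddCommGroup V] [Module ℝ V] (Q : QuadraticForm ℝ V)
    (W : Submodule ℝ V) (p q : ℕ) : Prop :=
  Module.Finite ℝ W ∧ Module.finrank ℝ W = p + q ∧
    sigPos (Q.restrict W) = p ∧ sigNeg (Q.restrict W) = q

end Signature

section ZariskiGeneral

variable {M : Type*} [AddCommGroup M] [Module ℝ M]

/-- The algebra of polynomial functions on `k`-tuples of vectors of the real vector space `M`: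
the algebra generated by the linear functionals on `M ^ k`. -/
def polynomialFunctions (M : Type*) [AddCommGroup M] [Module ℝ M] (k : ℕ) :
    Subalgebra ℝ ((Fin k → M) → ℝ) :=
  Algebra.adjoin ℝ
    (Set.range fun φ : Module.Dual ℝ (Fin k → M) => (φ : (Fin k → M) → ℝ))

/-- `Z` is a Zariski closed subset of the space `X` of `k`-dimensional subspaces of `M`
(for the Zariski topology that `X` has as a subset of the Grassmannian, a quotient of the space of
linearly independent `k`-tuples): membership in `Z` is a system of polynomial equations on the
bases of a subspace. -/
def IsZariskiClosedIn (k : ℕ) (X Z : Set (Submodule ℝ M)) : Prop :=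
  Z ⊆ X ∧ ∃ F : Set ((Fin k → M) → ℝ), F ⊆ polynomialFunctions M k ∧
    ∀ v : Fin k → M, LinearIndependent ℝ v → Submodule.span ℝ (Set.range v) ∈ X →
      (Submodule.span ℝ (Set.range v) ∈ Z ↔ ∀ f ∈ F, f v = 0)

/-- `Z` is a Zariski closed subset of positive codimension of `X`, that is, it contains no
irreducible component of `X`; equivalently, its complement is Zariski dense in `X`. -/
def IsThinIn (k : ℕ) (X Z : Set (Submodule ℝ M)) : Prop :=
  IsZariskiClosedIn k X Z ∧ ∀ Z', IsZariskiClosedIn k X Z' → X ⊆ Z ∪ Z' → X ⊆ Z'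

/-- The property `p` holds for a general element of the space `X` of `k`-dimensional subspaces:
it holds outside a countable union of Zariski closed subsets of positive codimension. -/
def ForGeneral (k : ℕ) (X : Set (Submodule ℝ M)) (p : Submodule ℝ M → Prop) : Prop :=
  ∃ Z : ℕ → Set (Submodule ℝ M), (∀ n, IsThinIn k X (Z n)) ∧ ∀ W ∈ X, (∀ n, W ∉ Z n) → p W

end ZariskiGeneral

section Orthogonal

variable {V : Type*} [AddCommGroup V] [Module ℝ V]

/-- For a subspace `U` of `V` on which `Q` is nondegenerate, `SO(U)` as a subgroup of `GL(V)`: the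
isometries of determinant one acting trivially on the orthogonal complement of `U`. -/
def specialOrthogonal (Q : QuadraticForm ℝ V) (U : Submodule ℝ V) :
    Subgroup (LinearMap.GeneralLinearGroup ℝ V) where
  carrier := {g | (∀ x, Q ((g : Module.End ℝ V) x) = Q x) ∧
    LinearMap.det (g : Module.End ℝ V) = 1 ∧
    ∀ x, (∀ u ∈ U, Q.IsOrtho u x) → (g : Module.End ℝ V) x = x}
  one_mem' := by simp
  mul_mem' := by
    rintro a b ⟨ha, ha', ha''⟩ ⟨hb, hb', hb''⟩
    refine ⟨fun x => ?_, ?_, fun x hx => ?_⟩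
    · simp [Module.End.mul_apply, ha, hb]
    · simp [ha', hb']
    · simp [Module.End.mul_apply, ha'' x hx, hb'' x hx]
  inv_mem' := by
    rintro a ⟨ha, ha', ha''⟩
    have h : ∀ x, (a : Module.End ℝ V)
        (((a⁻¹ : LinearMap.GeneralLinearGroup ℝ V) : Module.End ℝ V) x) = x := by
      intro x
      rw [← Module.End.mul_apply, Units.mul_inv, Module.End.one_apply]
    have h' : ∀ x, ((a⁻¹ : LinearMap.GeneralLinearGroup ℝ V) : Module.End ℝ V)
        ((a : Module.End ℝ V) x) = x := by
      intro x
      rw [← Module.End.mul_apply, Units.inv_mul, Module.End.one_apply]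
    refine ⟨fun x => ?_, ?_, fun x hx => ?_⟩
    · rw [← ha, h]
    · have := congrArg LinearMap.det (Units.mul_inv a)
      rw [map_mul, ha', one_mul, map_one] at this
      exact this
    · conv_lhs => rw [← ha'' x hx]
      exact h' x

/-- `SO⁺(U)`: the connected component of the identity in `SO(U)`, for the usual topology of
matrix groups (induced by the canonical topology of the finite-dimensional space `End(V)`). -/
def specialOrthogonalPlus (Q : QuadraticForm ℝ V) (U : Submodule ℝ V) :
    Set (LinearMap.GeneralLinearGroup ℝ V) :=
  letI : TopologicalSpace (LinearMap.GeneralLinearGroup ℝ V) :=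
    TopologicalSpace.induced (fun g => (g : Module.End ℝ V))
      (moduleTopology ℝ (Module.End ℝ V))
  connectedComponentIn (specialOrthogonal Q U : Set (LinearMap.GeneralLinearGroup ℝ V)) 1

/-- The exponential `∑ Nⁱ / i!` of a nilpotent endomorphism `N`, a finite sum. -/
def nilpotentExp (N : Module.End ℝ V) : Module.End ℝ V :=
  ∑ i ∈ Finset.range (nilpotencyClass N), ((i.factorial : ℝ)⁻¹) • N ^ i

/-- `H` is a one-parameter unipotent subgroup `{exp(tN) | t ∈ ℝ}` with `N ≠ 0` nilpotent, and
its Lie algebra is the line `L = ℝ N` of `End(V)`. -/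
def IsOneParameterUnipotent (H : Subgroup (LinearMap.GeneralLinearGroup ℝ V))
    (L : Submodule ℝ (Module.End ℝ V)) : Prop :=
  ∃ N : Module.End ℝ V, N ≠ 0 ∧ IsNilpotent N ∧ L = Submodule.span ℝ {N} ∧
    ∀ g : LinearMap.GeneralLinearGroup ℝ V,
      g ∈ H ↔ ∃ t : ℝ, (g : Module.End ℝ V) = nilpotentExp (t • N)

/-- The space of one-parameter unipotent subgroups of `SO(W)`, each represented by its Lie
algebra, a point of the projective space of `End(V)`. -/
def unipotentDirections (Q : QuadraticForm ℝ V) (W : Submodule ℝ V) :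
    Set (Submodule ℝ (Module.End ℝ V)) :=
  {L | ∃ H ≤ specialOrthogonal Q W, IsOneParameterUnipotent H L}

end Orthogonal

section RationalSubgroups

variable (E : Type*) [AddCommGroup E] [Module ℚ E] [FiniteDimensional ℚ E]

/-- Polynomials with rational coefficients in the matrix entries of an endomorphism of `E`. -/
abbrev RationalPolynomial : Type :=
  MvPolynomial (Fin (Module.finrank ℚ E) × Fin (Module.finrank ℚ E)) ℚ

/-- The common zeros in `GL(K ⊗ E)` of a set of polynomials with rational coefficients, the
matrix entries being taken with respect to a basis of the rational space `E`. -/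
def zeroLocus (K : Type*) [Field K] [Algebra ℚ K] (F : Set (RationalPolynomial E)) :
    Set (LinearMap.GeneralLinearGroup K (K ⊗[ℚ] E)) :=
  {g | ∀ f ∈ F, MvPolynomial.aeval (fun ij =>
    LinearMap.toMatrix ((Module.finBasis ℚ E).baseChange K) ((Module.finBasis ℚ E).baseChange K)
      (g : Module.End K (K ⊗[ℚ] E)) ij.1 ij.2) f = 0}

variable {E}

/-- A rational Lie subgroup: the group of real points of an algebraic group defined over `ℚ`,
that is, of a Zariski closed subgroup of `GL(ℂ ⊗ E)` cut out by polynomials with rational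
coefficients. -/
def IsRationalLieSubgroup (S : Subgroup (LinearMap.GeneralLinearGroup ℝ (ℝ ⊗[ℚ] E))) : Prop :=
  ∃ F : Set (RationalPolynomial E),
    (∃ G : Subgroup (LinearMap.GeneralLinearGroup ℂ (ℂ ⊗[ℚ] E)),
      (G : Set (LinearMap.GeneralLinearGroup ℂ (ℂ ⊗[ℚ] E))) = zeroLocus E ℂ F) ∧
    (S : Set (LinearMap.GeneralLinearGroup ℝ (ℝ ⊗[ℚ] E))) = zeroLocus E ℝ F

/-- The intersection of all rational Lie subgroups containing `H`; it is the smallest one by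
`rationalHull_isLeast`. -/
def rationalHull (H : Subgroup (LinearMap.GeneralLinearGroup ℝ (ℝ ⊗[ℚ] E))) :
    Subgroup (LinearMap.GeneralLinearGroup ℝ (ℝ ⊗[ℚ] E)) :=
  sInf {S | IsRationalLieSubgroup S ∧ H ≤ S}

theorem rationalHull_isLeast (H : Subgroup (LinearMap.GeneralLinearGroup ℝ (ℝ ⊗[ℚ] E))) :
    IsLeast {S | IsRationalLieSubgroup S ∧ H ≤ S} (rationalHull H) := by
  refine ⟨⟨?_, le_sInf fun S hS => hS.2⟩, fun S hS => sInf_le hS⟩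
  have key : ∀ S : {S : Subgroup (LinearMap.GeneralLinearGroup ℝ (ℝ ⊗[ℚ] E)) //
      IsRationalLieSubgroup S ∧ H ≤ S}, ∃ F : Set (RationalPolynomial E),
    (∃ G : Subgroup (LinearMap.GeneralLinearGroup ℂ (ℂ ⊗[ℚ] E)),
      (G : Set (LinearMap.GeneralLinearGroup ℂ (ℂ ⊗[ℚ] E))) = zeroLocus E ℂ F) ∧
    ((S : Subgroup (LinearMap.GeneralLinearGroup ℝ (ℝ ⊗[ℚ] E))) :
      Set (LinearMap.GeneralLinearGroup ℝ (ℝ ⊗[ℚ] E))) = zeroLocus E ℝ F :=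
    fun S => S.2.1
  choose F hF hS using key
  choose G hG using hF
  refine ⟨⋃ S, F S, ⟨⨅ S, G S, ?_⟩, ?_⟩
  · ext g
    simp only [Subgroup.coe_iInf, hG, Set.mem_iInter, zeroLocus, Set.mem_ofPred_eq,
      Set.mem_iUnion]
    exact ⟨fun h f ⟨S, hf⟩ => h S f hf, fun h S f hf => h f ⟨S, hf⟩⟩
  · have h1 : rationalHull H = ⨅ S : {S : Subgroup (LinearMap.GeneralLinearGroup ℝ (ℝ ⊗[ℚ] E)) //
        IsRationalLieSubgroup S ∧ H ≤ S}, (S : Subgroup _) := sInf_eq_iInf' _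
    rw [h1]
    ext g
    simp only [Subgroup.coe_iInf, hS, Set.mem_iInter, zeroLocus, Set.mem_ofPred_eq,
      Set.mem_iUnion]
    exact ⟨fun h f ⟨S, hf⟩ => h S f hf, fun h S f hf => h f ⟨S, hf⟩⟩

end RationalSubgroups

end RationalHull

end

/-! The rational structure enters only through countability: there are countably many polynomials
with rational coefficients, so a general choice can avoid, for all of them at once, the subspaces or
lines on which one vanishes by accident. Any equation of a rational group that holds at a general
point of an irreducible parameter space then holds at every point of it. Let `S` be a rational Lie
subgroup containing `H₀`.

Step one, inside `W`: the nilpotent lines in the Lie algebra of `SO(W)` form a conic, parametrised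
by squares of complex numbers. For a general line `L`, each equation of `S` that holds on `exp L`
holds on `exp L'` for every such `L'`, so `S` contains all unipotents of `SO(W)`. If `e` is
isotropic and orthogonal to `f`, the product of the reflections in `f` and `f + e` is unipotent
(`quadExp_wedge`). Moving along ruling lines of the hyperboloid `Q = -1` therefore puts products of
two reflections into `S` (`IsLorentzBasis.reflection_mul_mem`).

Step two, from `W` to `V₁`: after clearing denominators, an equation of `S` at a product of
reflections is a polynomial in the two vectors. It vanishes near one pair in `W`, hence on `W × W`;
by generality of `W` it vanishes on `W' × W'` for every admissible `W'`. Any `x`, `y` in `V₁` are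
reached by deforming a basis of `W` ending in the generator `p` of `P` towards `(x, y, p)`, so the
polynomial vanishes on `V₁ × V₁`.

By Cartan–Dieudonné (`mem_closure_reflectionSet`), products of two reflections generate `SO(V₁)`, so
`S` contains all of `SO(V₁)`, not only its identity component. `LineConnected` plays the role of
irreducibility throughout. -/

namespace RationalHull

/-! ### Polynomial functions and polynomial maps without coordinates -/

section PolynomialMaps

variable {M N N₁ N₂ N₃ : Type*} [AddCommGroup M] [Module ℝ M] [AddCommGroup N] [Module ℝ N]
  [AddCommGroup N₁] [Module ℝ N₁] [AddCommGroup N₂] [Module ℝ N₂] [AddCommGroup N₃] [Module ℝ N₃]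

/-- The algebra of polynomial functions on a real vector space, generated by the linear
functionals. -/
def polyAlgebra (M : Type*) [AddCommGroup M] [Module ℝ M] : Subalgebra ℝ (M → ℝ) :=
  Algebra.adjoin ℝ (Set.range fun φ : Module.Dual ℝ M => (φ : M → ℝ))

theorem dual_mem_polyAlgebra (φ : Module.Dual ℝ M) : (fun x => φ x) ∈ polyAlgebra M :=
  Algebra.subset_adjoin ⟨φ, rfl⟩

theorem const_mem_polyAlgebra (c : ℝ) : (fun _ => c) ∈ polyAlgebra M :=
  (polyAlgebra M).algebraMap_mem c

theorem add_mem_polyAlgebra {f g : M → ℝ} (hf : f ∈ polyAlgebra M) (hg : g ∈ polyAlgebra M) :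
    (fun x => f x + g x) ∈ polyAlgebra M := (polyAlgebra M).add_mem hf hg

theorem mul_mem_polyAlgebra {f g : M → ℝ} (hf : f ∈ polyAlgebra M) (hg : g ∈ polyAlgebra M) :
    (fun x => f x * g x) ∈ polyAlgebra M := (polyAlgebra M).mul_mem hf hg

theorem pow_mem_polyAlgebra {f : M → ℝ} (hf : f ∈ polyAlgebra M) (k : ℕ) :
    (fun x => f x ^ k) ∈ polyAlgebra M := (polyAlgebra M).pow_mem hf k

theorem sum_mem_polyAlgebra {ι : Type*} (s : Finset ι) {f : ι → M → ℝ}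
    (hf : ∀ i, f i ∈ polyAlgebra M) : (fun x => ∑ i ∈ s, f i x) ∈ polyAlgebra M := by
  have := (polyAlgebra M).sum_mem (t := s) fun i _ => hf i
  convert this using 1
  ext x
  simp

/-- A map between real vector spaces is polynomial if its composition with each linear functional
is a polynomial function. -/
def IsPolyMap (φ : M → N) : Prop :=
  ∀ l : Module.Dual ℝ N, (fun x => l (φ x)) ∈ polyAlgebra M

theorem IsPolyMap.comp_mem {φ : M → N} (hφ : IsPolyMap φ) {f : N → ℝ} (hf : f ∈ polyAlgebra N) :
    (fun x => f (φ x)) ∈ polyAlgebra M := by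
  unfold polyAlgebra at hf
  induction hf using Algebra.adjoin_induction with
  | mem g hg =>
    obtain ⟨l, rfl⟩ := hg
    exact hφ l
  | algebraMap r => exact const_mem_polyAlgebra r
  | add g h _ _ hg hh => exact add_mem_polyAlgebra hg hh
  | mul g h _ _ hg hh => exact mul_mem_polyAlgebra hg hh

theorem IsPolyMap.comp {φ : M → N} (hφ : IsPolyMap φ) {ψ : N → N₁} (hψ : IsPolyMap ψ) :
    IsPolyMap fun x => ψ (φ x) := fun l => hφ.comp_mem (hψ l)

theorem IsPolyMap.linear (T : M →ₗ[ℝ] N) : IsPolyMap fun x => T x :=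
  fun l => dual_mem_polyAlgebra (l ∘ₗ T)

theorem IsPolyMap.id : IsPolyMap fun x : M => x := dual_mem_polyAlgebra

theorem IsPolyMap.apply {ι : Type*} (i : ι) : IsPolyMap fun v : ι → N => v i :=
  fun l => dual_mem_polyAlgebra (l ∘ₗ LinearMap.proj (R := ℝ) (φ := fun _ : ι => N) i)

theorem IsPolyMap.const (y : N) : IsPolyMap fun _ : M => y :=
  fun l => const_mem_polyAlgebra (l y)

theorem IsPolyMap.of_mem {f : M → ℝ} (hf : f ∈ polyAlgebra M) : IsPolyMap f := fun l => by
  have h : (fun x => l (f x)) = fun x => f x * l 1 := by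
    ext x
    rw [← smul_eq_mul, ← map_smul, smul_eq_mul, mul_one]
  rw [h]
  exact mul_mem_polyAlgebra hf (const_mem_polyAlgebra _)

theorem IsPolyMap.mem {f : M → ℝ} (hf : IsPolyMap f) : f ∈ polyAlgebra M := hf LinearMap.id

theorem IsPolyMap.add {φ ψ : M → N} (hφ : IsPolyMap φ) (hψ : IsPolyMap ψ) :
    IsPolyMap fun x => φ x + ψ x := fun l => by
  simpa using add_mem_polyAlgebra (hφ l) (hψ l)

theorem IsPolyMap.smul {f : M → ℝ} (hf : f ∈ polyAlgebra M) {ψ : M → N} (hψ : IsPolyMap ψ) :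
    IsPolyMap fun x => f x • ψ x := fun l => by
  simpa using mul_mem_polyAlgebra hf (hψ l)

theorem IsPolyMap.sub {φ ψ : M → N} (hφ : IsPolyMap φ) (hψ : IsPolyMap ψ) :
    IsPolyMap fun x => φ x - ψ x := by
  convert hφ.add (IsPolyMap.smul (const_mem_polyAlgebra (-1)) hψ) using 2
  module

theorem IsPolyMap.sum {ι : Type*} (s : Finset ι) {φ : ι → M → N} (hφ : ∀ i, IsPolyMap (φ i)) :
    IsPolyMap fun x => ∑ i ∈ s, φ i x := fun l => by
  simpa using sum_mem_polyAlgebra s fun i => hφ i l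

theorem IsPolyMap.prodMk {φ : M → N₁} {ψ : M → N₂} (hφ : IsPolyMap φ) (hψ : IsPolyMap ψ) :
    IsPolyMap fun x => (φ x, ψ x) := fun l => by
  have h : (fun x => l (φ x, ψ x)) =
      fun x => (l ∘ₗ LinearMap.inl ℝ N₁ N₂) (φ x) + (l ∘ₗ LinearMap.inr ℝ N₁ N₂) (ψ x) := by
    ext x
    simp [← map_add]
  rw [h]
  exact add_mem_polyAlgebra (hφ _) (hψ _)

theorem IsPolyMap.pi {ι : Type*} [Fintype ι] [DecidableEq ι] {φ : ι → M → N}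
    (hφ : ∀ i, IsPolyMap (φ i)) : IsPolyMap fun x i => φ i x := by
  have h : (fun x i => φ i x) = fun x => ∑ i, LinearMap.single ℝ (fun _ : ι => N) i (φ i x) := by
    ext x j
    simp [Finset.sum_apply, Pi.single_apply]
  rw [h]
  exact IsPolyMap.sum _ fun i => (hφ i).comp (IsPolyMap.linear _)

theorem IsPolyMap.bilinear [Module.Finite ℝ N₁] (T : N₁ →ₗ[ℝ] N₂ →ₗ[ℝ] N₃) {φ : M → N₁}
    {ψ : M → N₂} (hφ : IsPolyMap φ) (hψ : IsPolyMap ψ) : IsPolyMap fun x => T (φ x) (ψ x) := by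
  let b := Module.finBasis ℝ N₁
  have h : (fun x => T (φ x) (ψ x)) = fun x => ∑ i, b.coord i (φ x) • T (b i) (ψ x) := by
    ext x
    conv_lhs => rw [← b.sum_repr (φ x)]
    simp only [map_sum, map_smul, LinearMap.sum_apply, LinearMap.smul_apply,
      Module.Basis.coord_apply]
  rw [h]
  exact IsPolyMap.sum _ fun i => IsPolyMap.smul (hφ _) (hψ.comp (IsPolyMap.linear _))

theorem IsPolyMap.mul [Module.Finite ℝ N] {φ ψ : M → Module.End ℝ N} (hφ : IsPolyMap φ)
    (hψ : IsPolyMap ψ) : IsPolyMap fun x => φ x * ψ x :=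
  IsPolyMap.bilinear (LinearMap.mul ℝ (Module.End ℝ N)) hφ hψ

theorem IsPolyMap.line (x y : M) : IsPolyMap fun t : ℝ => x + t • (y - x) :=
  (IsPolyMap.const x).add (IsPolyMap.smul (IsPolyMap.id.mem) (IsPolyMap.const _))

theorem exists_polynomial_of_mem {f : ℝ → ℝ} (hf : f ∈ polyAlgebra ℝ) :
    ∃ p : Polynomial ℝ, ∀ t, f t = p.eval t := by
  unfold polyAlgebra at hf
  induction hf using Algebra.adjoin_induction with
  | mem g hg =>
    obtain ⟨l, rfl⟩ := hg
    refine ⟨Polynomial.C (l 1) * Polynomial.X, fun t => ?_⟩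
    have h : l t = t * l 1 := by
      rw [← smul_eq_mul, ← map_smul, smul_eq_mul, mul_one]
    change l t = _
    rw [h, Polynomial.eval_mul, Polynomial.eval_C, Polynomial.eval_X, mul_comm]
  | algebraMap r => exact ⟨Polynomial.C r, fun t => by simp⟩
  | add g h _ _ hg hh =>
    obtain ⟨p, hp⟩ := hg
    obtain ⟨q, hq⟩ := hh
    exact ⟨p + q, fun t => by simp [hp, hq]⟩
  | mul g h _ _ hg hh =>
    obtain ⟨p, hp⟩ := hg
    obtain ⟨q, hq⟩ := hh
    exact ⟨p * q, fun t => by simp [hp, hq]⟩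

theorem continuous_of_mem {f : ℝ → ℝ} (hf : f ∈ polyAlgebra ℝ) : Continuous f := by
  obtain ⟨p, hp⟩ := exists_polynomial_of_mem hf
  rw [funext hp]
  exact p.continuous

theorem eq_zero_of_infinite_zeros {f : ℝ → ℝ} (hf : f ∈ polyAlgebra ℝ)
    (h : {t | f t = 0}.Infinite) (t : ℝ) : f t = 0 := by
  obtain ⟨p, hp⟩ := exists_polynomial_of_mem hf
  have : p = 0 := Polynomial.eq_zero_of_infinite_isRoot p <| by
    simpa only [Polynomial.IsRoot, hp] using h
  rw [hp, this, Polynomial.eval_zero]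

/-- Let `f` be a polynomial function that vanishes at the points of a line close to a point `x`
of the line; then it vanishes at all points of the line. -/
theorem eq_zero_of_eventually_line {f : M → ℝ} (hf : f ∈ polyAlgebra M) (x y : M)
    (h : ∀ᶠ t in nhds (0 : ℝ), f (x + t • (y - x)) = 0) : f y = 0 := by
  have := eq_zero_of_infinite_zeros ((IsPolyMap.line x y).comp_mem hf)
    (infinite_of_mem_nhds 0 h) 1
  simpa using this

theorem eventually_pos_line {f : M → ℝ} (hf : f ∈ polyAlgebra M) {x : M} (y : M)
    (h : 0 < f x) : ∀ᶠ t in nhds (0 : ℝ), 0 < f (x + t • (y - x)) := by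
  have := (continuous_of_mem ((IsPolyMap.line x y).comp_mem hf)).continuousAt (x := 0)
  exact this.eventually_const_lt (by simpa using h)

theorem eventually_ne_zero_line {f : M → ℝ} (hf : f ∈ polyAlgebra M) {x : M} (y : M)
    (h : f x ≠ 0) : ∀ᶠ t in nhds (0 : ℝ), f (x + t • (y - x)) ≠ 0 := by
  have := (continuous_of_mem ((IsPolyMap.line x y).comp_mem hf)).continuousAt (x := 0)
  exact this.eventually_ne (by simpa using h)

/-- A polynomial curve `a + t • φ t` that vanishes for `t ≠ 0` has `a = 0`. -/
theorem eq_zero_of_add_smul_eq_zero {a : N} {φ : ℝ → N} (hφ : IsPolyMap φ)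
    (h : ∀ t : ℝ, t ≠ 0 → a + t • φ t = 0) : a = 0 := by
  rw [← Module.forall_dual_apply_eq_zero_iff ℝ a]
  intro l
  have h1 := ((IsPolyMap.const a).add (IsPolyMap.smul IsPolyMap.id.mem hφ)) l
  have h2 := eq_zero_of_infinite_zeros h1
    ((Set.finite_singleton (0 : ℝ)).infinite_compl.mono fun t ht => by
      change l (a + t • φ t) = 0; rw [h t ht, map_zero]) 0
  simpa using h2

/-- If `g` is a polynomial in the components of `A x / D x`, then it becomes polynomial in `x`
after multiplication by a power of `D`. -/
theorem exists_clear_denominator {D : M → ℝ} (hD : D ∈ polyAlgebra M) {A : M → N}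
    (hA : IsPolyMap A) {g : N → ℝ} (hg : g ∈ polyAlgebra N) :
    ∃ p ∈ polyAlgebra M, ∃ k : ℕ, ∀ x, D x ≠ 0 → p x = D x ^ k * g ((D x)⁻¹ • A x) := by
  unfold polyAlgebra at hg
  induction hg using Algebra.adjoin_induction with
  | mem g hg =>
    obtain ⟨l, rfl⟩ := hg
    exact ⟨_, hA l, 1, fun x hx => by simp [hx]⟩
  | algebraMap r => exact ⟨_, const_mem_polyAlgebra r, 0, fun x hx => by simp⟩
  | add g h _ _ hg hh =>
    obtain ⟨p, hp, k, hpk⟩ := hg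
    obtain ⟨q, hq, m, hqm⟩ := hh
    refine ⟨_, add_mem_polyAlgebra (mul_mem_polyAlgebra (pow_mem_polyAlgebra hD m) hp)
      (mul_mem_polyAlgebra (pow_mem_polyAlgebra hD k) hq), k + m, fun x hx => ?_⟩
    simp only [hpk x hx, hqm x hx, Pi.add_apply]
    ring
  | mul g h _ _ hg hh =>
    obtain ⟨p, hp, k, hpk⟩ := hg
    obtain ⟨q, hq, m, hqm⟩ := hh
    refine ⟨_, mul_mem_polyAlgebra hp hq, k + m, fun x hx => ?_⟩
    simp only [hpk x hx, hqm x hx, Pi.mul_apply]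
    ring

end PolynomialMaps

/-! ### Irreducibility of parameter spaces by means of polynomial curves -/

section General

variable {M : Type*} [AddCommGroup M] [Module ℝ M] {k : ℕ} {X : Set (Submodule ℝ M)}

/-- Any two elements of `X` have bases that are joined by a line, the points of which near the
first basis are bases of elements of `X`. -/
def LineConnected (k : ℕ) (X : Set (Submodule ℝ M)) : Prop :=
  ∀ W ∈ X, ∀ W' ∈ X, ∃ γ : ℝ → Fin k → M, IsPolyMap γ ∧
    Submodule.span ℝ (Set.range (γ 0)) = W ∧
    LinearIndependent ℝ (γ 1) ∧ Submodule.span ℝ (Set.range (γ 1)) = W' ∧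
    ∀ᶠ t in nhds (0 : ℝ), LinearIndependent ℝ (γ t) ∧ Submodule.span ℝ (Set.range (γ t)) ∈ X

/-- The usual irreducibility argument: an equation of `Z` that fails at `γ 0` and an equation of
`Z'` that fails at `γ 1` pull back to two nonzero polynomials in `t`. Their product vanishes for all
small `t`, because `X` is covered by `Z` and `Z'`. -/
theorem LineConnected.isThinIn (hX : LineConnected k X) {Z : Set (Submodule ℝ M)}
    (hZ : IsZariskiClosedIn k X Z) (hne : ¬ X ⊆ Z) : IsThinIn k X Z := by
  refine ⟨hZ, fun Z' hZ' hcov W' hW' => ?_⟩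
  by_contra hW'Z'
  obtain ⟨W, hW, hWZ⟩ := Set.not_subset.1 hne
  obtain ⟨γ, hγ, h0, hl1, h1, hev⟩ := hX W hW W' hW'
  obtain ⟨-, F, hF, hFZ⟩ := hZ
  obtain ⟨-, F', hF', hFZ'⟩ := hZ'
  have hl0 := hev.self_of_nhds.1
  have hn := hFZ (γ 0) hl0 (h0 ▸ hW)
  have hn' := hFZ' (γ 1) hl1 (h1 ▸ hW')
  rw [h0] at hn
  rw [h1] at hn'
  have hn := mt hn.2 hWZ
  have hn' := mt hn'.2 hW'Z'
  push Not at hn hn'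
  obtain ⟨f, hf, hf0⟩ := hn
  obtain ⟨f', hf', hf1⟩ := hn'
  obtain ⟨p, hp⟩ := exists_polynomial_of_mem (hγ.comp_mem (hF hf))
  obtain ⟨p', hp'⟩ := exists_polynomial_of_mem (hγ.comp_mem (hF' hf'))
  have hpp : p * p' = 0 := by
    refine Polynomial.eq_zero_of_infinite_isRoot _ ((infinite_of_mem_nhds 0 hev).mono ?_)
    rintro t ⟨hlt, hXt⟩
    have : p.eval t = 0 ∨ p'.eval t = 0 := by
      rcases hcov hXt with h | h
      · exact Or.inl ((hp t).symm.trans ((hFZ _ hlt hXt).1 h f hf))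
      · exact Or.inr ((hp' t).symm.trans ((hFZ' _ hlt hXt).1 h f' hf'))
    simpa [Polynomial.IsRoot] using this
  rcases mul_eq_zero.1 hpp with h | h
  · exact hf0 (by rw [hp, h, Polynomial.eval_zero])
  · exact hf1 (by rw [hp', h, Polynomial.eval_zero])

theorem isThinIn_empty : IsThinIn k X ∅ :=
  ⟨⟨Set.empty_subset _, Set.univ ∩ {fun _ => 1}, by
    rintro f ⟨-, rfl⟩
    exact const_mem_polyAlgebra (M := Fin k → M) 1, fun v _ _ => by simp⟩,
    fun Z' _ h => by simpa using h⟩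

/-- The exceptional sets are those `Z i` that do not contain all of `X`. This is how genericity is
used: a closed condition satisfied by a general element is satisfied identically. -/
theorem LineConnected.forGeneral (hX : LineConnected k X) {ι : Type*} [Countable ι]
    {Z : ι → Set (Submodule ℝ M)} (hZ : ∀ i, IsZariskiClosedIn k X (Z i)) :
    ForGeneral k X fun W => ∀ i, W ∈ Z i → X ⊆ Z i := by
  classical
  rcases isEmpty_or_nonempty ι with hι | hι
  · exact ⟨fun _ => ∅, fun _ => isThinIn_empty, fun _ _ _ i => hι.elim i⟩
  obtain ⟨e, he⟩ := exists_surjective_nat ι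
  refine ⟨fun n => if X ⊆ Z (e n) then ∅ else Z (e n), fun n => ?_, fun W _ h i hi => ?_⟩
  · dsimp only
    split_ifs with h
    · exact isThinIn_empty
    · exact hX.isThinIn (hZ _) h
  · obtain ⟨n, rfl⟩ := he i
    by_contra hn
    exact h n (by simpa [hn] using hi)

theorem ForGeneral.mono {p p' : Submodule ℝ M → Prop} (h : ForGeneral k X p)
    (hp : ∀ W ∈ X, p W → p' W) : ForGeneral k X p' := by
  obtain ⟨Z, hZ, h⟩ := h
  exact ⟨Z, hZ, fun W hW hn => hp W hW (h W hW hn)⟩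

end General

/-! ### Reflections and the Cartan–Dieudonné theorem -/

section Quadratic

variable {V : Type*} [AddCommGroup V] [Module ℝ V] (Q : QuadraticForm ℝ V)

/-- The polar form of `Q`, normalised by `bil Q x x = 2 * Q x`. -/
abbrev bil : LinearMap.BilinForm ℝ V := QuadraticMap.polarBilin Q

theorem bil_comm (x y : V) : bil Q x y = bil Q y x := by
  simp [QuadraticMap.polar_comm]

theorem bil_self (x : V) : bil Q x x = 2 * Q x := by
  simp [QuadraticMap.polar_self]

theorem map_add_eq (x y : V) : Q (x + y) = Q x + Q y + bil Q x y := by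
  simp [QuadraticMap.polar]

theorem map_smul_eq (c : ℝ) (x : V) : Q (c • x) = c * c * Q x := by
  simp [QuadraticMap.map_smul]

variable {Q} in
theorem isOrtho_iff_bil {x y : V} : Q.IsOrtho x y ↔ bil Q x y = 0 := by
  rw [QuadraticMap.isOrtho_def, map_add_eq]
  constructor <;> intro h <;> linarith

variable {Q} in
theorem bil_map_of_isometry {g : Module.End ℝ V} (hg : ∀ x, Q (g x) = Q x) (x y : V) :
    bil Q (g x) (g y) = bil Q x y := by
  have h := hg (x + y)
  rw [map_add, map_add_eq, map_add_eq, hg, hg] at h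
  linarith

/-- The reflection in the hyperplane orthogonal to `u`. -/
noncomputable def hyperplaneReflection (u : V) : Module.End ℝ V :=
  LinearMap.transvection (-(Q u)⁻¹ • bil Q u) u

theorem hyperplaneReflection_apply (u x : V) :
    hyperplaneReflection Q u x = x - ((Q u)⁻¹ * bil Q u x) • u := by
  rw [hyperplaneReflection, LinearMap.transvection.apply, LinearMap.smul_apply, smul_eq_mul,
    neg_mul, neg_smul, sub_eq_add_neg]

theorem det_hyperplaneReflection [Module.Finite ℝ V] {u : V} (hu : Q u ≠ 0) :
    LinearMap.det (hyperplaneReflection Q u) = -1 := by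
  rw [hyperplaneReflection, LinearMap.transvection.det, LinearMap.smul_apply, bil_self,
    smul_eq_mul]
  field_simp
  norm_num

theorem hyperplaneReflection_mul_self {u : V} (hu : Q u ≠ 0) :
    hyperplaneReflection Q u * hyperplaneReflection Q u = 1 := by
  ext x
  simp only [Module.End.mul_apply, hyperplaneReflection_apply, map_sub, map_smul, bil_self,
    Module.End.one_apply]
  match_scalars
  · ring
  · field_simp
    ring

theorem hyperplaneReflection_isometry {u : V} (hu : Q u ≠ 0) (x : V) :
    Q (hyperplaneReflection Q u x) = Q x := by
  rw [hyperplaneReflection_apply, sub_eq_add_neg, ← neg_smul, map_add_eq, map_smul_eq, map_smul,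
    smul_eq_mul, bil_comm Q x u]
  field_simp
  ring

theorem hyperplaneReflection_smul (c : ℝ) (hc : c ≠ 0) (u : V) :
    hyperplaneReflection Q (c • u) = hyperplaneReflection Q u := by
  ext x
  rw [hyperplaneReflection_apply, hyperplaneReflection_apply, map_smul_eq, map_smul,
    LinearMap.smul_apply, smul_eq_mul, smul_smul]
  congr 2
  by_cases hu : Q u = 0
  · simp [hu]
  · field_simp

/-- The reflection in a nonisotropic vector, as an element of the general linear group. -/
noncomputable def reflectionUnit {u : V} (hu : Q u ≠ 0) : LinearMap.GeneralLinearGroup ℝ V :=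
  ⟨hyperplaneReflection Q u, hyperplaneReflection Q u, hyperplaneReflection_mul_self Q hu,
    hyperplaneReflection_mul_self Q hu⟩

theorem reflectionUnit_coe {u : V} (hu : Q u ≠ 0) :
    (reflectionUnit Q hu : Module.End ℝ V) = hyperplaneReflection Q u := rfl

theorem reflectionUnit_mul_self {u : V} (hu : Q u ≠ 0) :
    reflectionUnit Q hu * reflectionUnit Q hu = 1 :=
  Units.ext (hyperplaneReflection_mul_self Q hu)

/-- The restriction of `Q` to `U` is nondegenerate. -/
def NondegenerateOn (U : Submodule ℝ V) : Prop :=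
  ∀ z ∈ U, (∀ y ∈ U, bil Q z y = 0) → z = 0

/-- The set of reflections in nonisotropic vectors of `U`. -/
def reflectionSet (U : Submodule ℝ V) : Set (LinearMap.GeneralLinearGroup ℝ V) :=
  {g | ∃ u ∈ U, ∃ hu : Q u ≠ 0, g = reflectionUnit Q hu}

variable {Q}

theorem exists_nonisotropic {U : Submodule ℝ V} (hU : NondegenerateOn Q U) (h0 : U ≠ ⊥) :
    ∃ x ∈ U, Q x ≠ 0 := by
  by_contra! h
  refine h0 ((Submodule.eq_bot_iff U).2 fun z hz => hU z hz fun y hy => ?_)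
  have := map_add_eq Q z y
  rw [h _ (U.add_mem hz hy), h _ hz, h _ hy] at this
  linarith

/-- The double orthogonal complement of `U` is `U`; this shows that an isometry fixing the
complement of `U` pointwise preserves `U`. -/
theorem mem_of_forall_bil [Module.Finite ℝ V] (hQ : NondegenerateOn Q ⊤) (U : Submodule ℝ V)
    {x : V} (hx : ∀ y, (∀ u ∈ U, bil Q u y = 0) → bil Q y x = 0) : x ∈ U := by
  have hrefl : (bil Q).IsRefl := fun x y h => by rw [bil_comm]; exact h
  have hnd : (bil Q).Nondegenerate :=
    ⟨fun x h => hQ x trivial fun y _ => h y,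
      fun x h => hQ x trivial fun y _ => by rw [bil_comm]; exact h y⟩
  rw [← LinearMap.BilinForm.orthogonal_orthogonal hnd hrefl U]
  exact fun y hy => hx y hy

/-- Cartan–Dieudonné by induction on `dim U`: once `g` has been corrected to fix a nonisotropic `x`,
it fixes the complement of `U' = U ∩ x^⊥` pointwise, and `U'` is again nondegenerate. -/
theorem mem_closure_reflectionSet [Module.Finite ℝ V] (hQ : NondegenerateOn Q ⊤) :
    ∀ (n : ℕ) (U : Submodule ℝ V), Module.finrank ℝ U = n → NondegenerateOn Q U →
      ∀ g : LinearMap.GeneralLinearGroup ℝ V, (∀ x, Q ((g : Module.End ℝ V) x) = Q x) →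
        (∀ x, (∀ u ∈ U, bil Q u x = 0) → (g : Module.End ℝ V) x = x) →
          g ∈ Subgroup.closure (reflectionSet Q U) := by
  intro n
  induction n using Nat.strong_induction_on with
  | _ n ih =>
    intro U hn hU g hg hfix
    by_cases h0 : U = ⊥
    · have : g = 1 := Units.ext (LinearMap.ext fun x => hfix x fun u hu => by
        rw [h0, Submodule.mem_bot] at hu
        simp [hu])
      rw [this]
      exact Subgroup.one_mem _
    obtain ⟨x, hx, hQx⟩ := exists_nonisotropic hU h0
    have hgx : (g : Module.End ℝ V) x ∈ U := mem_of_forall_bil hQ U fun y hy => by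
      rw [← hfix y hy, bil_map_of_isometry hg, bil_comm]
      exact hy x hx
    -- it suffices to correct `g` by reflections to an isometry that fixes `x`
    have key : ∀ h : LinearMap.GeneralLinearGroup ℝ V, h ∈ Subgroup.closure (reflectionSet Q U) →
        (∀ y, Q ((h : Module.End ℝ V) y) = Q y) →
        (∀ y, (∀ u ∈ U, bil Q u y = 0) → (h : Module.End ℝ V) y = y) →
        (h : Module.End ℝ V) ((g : Module.End ℝ V) x) = x →
        g ∈ Subgroup.closure (reflectionSet Q U) := by
      intro h hmem hiso hhfix hhx
      let U' : Submodule ℝ V := U ⊓ LinearMap.ker (bil Q x)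
      have hU'U : U' ≤ U := inf_le_left
      have hxU' : x ∉ U' := fun h => hQx (by
        have h2 : bil Q x x = 0 := h.2
        rw [bil_self] at h2
        linarith)
      have hdec : ∀ y : V, bil Q x (y - (bil Q x y / (2 * Q x)) • x) = 0 := fun y => by
        rw [map_sub, map_smul, bil_self, smul_eq_mul]
        field_simp
        ring
      have hperp : ∀ y, (∀ u ∈ U', bil Q u y = 0) → bil Q x y = 0 → ∀ u ∈ U, bil Q u y = 0 := by
        intro y hy hxy u hu
        have := hy _ ⟨U.sub_mem hu (U.smul_mem _ hx), hdec u⟩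
        simpa [hxy] using this
      have hrank : Module.finrank ℝ U' < n := by
        rw [← hn]
        exact Submodule.finrank_lt_finrank_of_lt
          (lt_of_le_of_ne hU'U fun h => hxU' (h ▸ hx))
      have hU' : NondegenerateOn Q U' := fun z hz hzU' => hU z hz.1 fun y hy => by
        rw [bil_comm]
        exact hperp z (fun u hu => by rw [bil_comm]; exact hzU' u hu) hz.2 y hy
      have hhg : h * g ∈ Subgroup.closure (reflectionSet Q U') := by
        refine ih _ hrank U' rfl hU' (h * g) (fun y => ?_) (fun y hy => ?_)
        · rw [Units.val_mul, Module.End.mul_apply, hiso, hg]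
        · have h1 := hperp (y - (bil Q x y / (2 * Q x)) • x) (fun u hu => by
            rw [map_sub, map_smul, hy u hu, bil_comm Q u x, (hu.2 : bil Q x u = 0), smul_zero,
              sub_zero]) (hdec y)
          have h2 : (h : Module.End ℝ V) ((g : Module.End ℝ V)
              (y - (bil Q x y / (2 * Q x)) • x)) = y - (bil Q x y / (2 * Q x)) • x := by
            rw [hfix _ h1, hhfix _ h1]
          rw [map_sub, map_sub, map_smul, map_smul, hhx, sub_left_inj] at h2
          rw [Units.val_mul, Module.End.mul_apply, h2]
      have hmono : reflectionSet Q U' ⊆ reflectionSet Q U :=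
        fun k ⟨u, hu, hQu, hk⟩ => ⟨u, hU'U hu, hQu, hk⟩
      have := Subgroup.mul_mem _ (Subgroup.inv_mem _ hmem) (Subgroup.closure_mono hmono hhg)
      rwa [inv_mul_cancel_left] at this
    have hfixr : ∀ u ∈ U, ∀ y, (∀ u ∈ U, bil Q u y = 0) → hyperplaneReflection Q u y = y :=
      fun u hu y hy => by simp [hyperplaneReflection_apply, hy u hu]
    set y := (g : Module.End ℝ V) x with hy
    have hQy : Q y = Q x := hg x
    have hm : Q (y - x) = 2 * Q x - bil Q y x := by
      rw [sub_eq_add_neg, map_add_eq, QuadraticMap.map_neg, map_neg, hQy]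
      ring
    have hp : Q (y + x) = 2 * Q x + bil Q y x := by
      rw [map_add_eq, hQy]
      ring
    -- Since `Q (y - x) + Q (y + x) = 4 * Q x ≠ 0`, one of the two vectors is nonisotropic. The
    -- reflection in `y - x` sends `y` to `x`; the one in `y + x` sends `y` to `-x`, which the
    -- reflection in `x` then corrects.
    by_cases hc : Q (y - x) = 0
    · have hc' : Q (y + x) ≠ 0 := by
        intro h
        apply hQx
        linarith
      have hmem : y + x ∈ U := U.add_mem hgx hx
      refine key (reflectionUnit Q hQx * reflectionUnit Q hc')
        (Subgroup.mul_mem _ (Subgroup.subset_closure ⟨x, hx, hQx, rfl⟩)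
          (Subgroup.subset_closure ⟨y + x, hmem, hc', rfl⟩)) (fun z => ?_) (fun z hz => ?_) ?_
      · rw [Units.val_mul, Module.End.mul_apply, reflectionUnit_coe, reflectionUnit_coe,
          hyperplaneReflection_isometry Q hQx, hyperplaneReflection_isometry Q hc']
      · rw [Units.val_mul, Module.End.mul_apply, reflectionUnit_coe, reflectionUnit_coe,
          hfixr _ hmem z hz, hfixr _ hx z hz]
      · have h1 : bil Q (y + x) y = Q (y + x) := by
          rw [hp, map_add, LinearMap.add_apply, bil_self, bil_comm Q x y, hQy]
        have h2 : hyperplaneReflection Q (y + x) y = -x := by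
          rw [hyperplaneReflection_apply, h1, inv_mul_cancel₀ hc', one_smul]
          abel
        rw [Units.val_mul, Module.End.mul_apply, reflectionUnit_coe, reflectionUnit_coe, h2,
          map_neg, hyperplaneReflection_apply, bil_self]
        match_scalars
        field_simp
        norm_num
    · have hmem : y - x ∈ U := U.sub_mem hgx hx
      refine key (reflectionUnit Q hc) (Subgroup.subset_closure ⟨y - x, hmem, hc, rfl⟩)
        (hyperplaneReflection_isometry Q hc) (hfixr _ hmem) ?_
      have h1 : bil Q (y - x) y = Q (y - x) := by
        rw [hm, map_sub, LinearMap.sub_apply, bil_self, bil_comm Q x y, hQy]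
      rw [reflectionUnit_coe, hyperplaneReflection_apply, h1, inv_mul_cancel₀ hc, one_smul]
      abel

/-- A subgroup that contains the products of two reflections in vectors of `U` contains
`SO(U)`. -/
theorem specialOrthogonal_le [Module.Finite ℝ V] (hQ : NondegenerateOn Q ⊤) {U : Submodule ℝ V}
    (hU : NondegenerateOn Q U) (S : Subgroup (LinearMap.GeneralLinearGroup ℝ V))
    (hS : ∀ u ∈ U, ∀ u' ∈ U, ∀ (hu : Q u ≠ 0) (hu' : Q u' ≠ 0),
      reflectionUnit Q hu * reflectionUnit Q hu' ∈ S) : specialOrthogonal Q U ≤ S := by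
  rintro g ⟨hg, hdet, hfix⟩
  have hmem := mem_closure_reflectionSet hQ _ U rfl hU g hg
    fun x hx => hfix x fun u hu => isOrtho_iff_bil.2 (hx u hu)
  -- Parity of the word in reflections, recorded by the determinant: even words lie in `S`, odd
  -- words do so after one more reflection, whichever it is.
  have key : (g ∈ S ∧ LinearMap.det (g : Module.End ℝ V) = 1) ∨
      ((∀ u ∈ U, ∀ hu : Q u ≠ 0, reflectionUnit Q hu * g ∈ S) ∧
        LinearMap.det (g : Module.End ℝ V) = -1) := by
    clear hg hdet hfix
    induction hmem using Subgroup.closure_induction_left with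
    | one => exact Or.inl ⟨S.one_mem, by simp⟩
    | mul_left r hr g _ ih =>
      obtain ⟨u, hu, hQu, rfl⟩ := hr
      rcases ih with ⟨h1, h2⟩ | ⟨h1, h2⟩
      · refine Or.inr ⟨fun u' hu' hQu' => ?_, ?_⟩
        · rw [← mul_assoc]
          exact S.mul_mem (hS _ hu' _ hu _ _) h1
        · rw [Units.val_mul, map_mul, reflectionUnit_coe, det_hyperplaneReflection Q hQu, h2,
            mul_one]
      · refine Or.inl ⟨h1 u hu hQu, ?_⟩
        rw [Units.val_mul, map_mul, reflectionUnit_coe, det_hyperplaneReflection Q hQu, h2]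
        norm_num
    | inv_mul_cancel r hr g _ ih =>
      obtain ⟨u, hu, hQu, rfl⟩ := hr
      have hinv : (reflectionUnit Q hQu)⁻¹ = reflectionUnit Q hQu :=
        inv_eq_of_mul_eq_one_left (reflectionUnit_mul_self Q hQu)
      rw [hinv]
      rcases ih with ⟨h1, h2⟩ | ⟨h1, h2⟩
      · refine Or.inr ⟨fun u' hu' hQu' => ?_, ?_⟩
        · rw [← mul_assoc]
          exact S.mul_mem (hS _ hu' _ hu _ _) h1
        · rw [Units.val_mul, map_mul, reflectionUnit_coe, det_hyperplaneReflection Q hQu, h2,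
            mul_one]
      · refine Or.inl ⟨h1 u hu hQu, ?_⟩
        rw [Units.val_mul, map_mul, reflectionUnit_coe, det_hyperplaneReflection Q hQu, h2]
        norm_num
  rcases key with ⟨h, -⟩ | ⟨-, h⟩
  · exact h
  · rw [hdet] at h
    norm_num at h

end Quadratic

/-! ### Signature, Lorentz bases and Gram determinants -/

section Signature

variable {V : Type*} [AddCommGroup V] [Module ℝ V] {Q : QuadraticForm ℝ V}

/-- The two indices of inertia already add up to the dimension, so nothing is left for the radical.
-/
theorem nondegenerateOn_of_hasSignature {W : Submodule ℝ V} {p q : ℕ}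
    (h : HasSignature Q W p q) : NondegenerateOn Q W := by
  obtain ⟨hfin, hrank, hp, hq⟩ := h
  have h1 := QuadraticForm.sigPos_add_sigNeg_add_radical (Q := Q.restrict W)
  have h2 : (Q.restrict W).radical = ⊥ := by
    rw [← Submodule.finrank_eq_zero (R := ℝ)]
    omega
  intro z hz hzW
  have h3 : (⟨z, hz⟩ : W) ∈ (Q.restrict W).radical := by
    rw [QuadraticMap.mem_radical_iff']
    have h0 : Q z = 0 := by
      have := hzW z hz
      rw [bil_self] at this
      linarith
    refine ⟨h0, fun n => ?_⟩
    change Q (z + n) = Q n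
    rw [map_add_eq, h0, hzW n n.2]
    ring
  rw [h2, Submodule.mem_bot] at h3
  exact congrArg Subtype.val h3

/-- The vectors `u 0`, `u 1`, `u 2` form an orthogonal basis of `W` with squares `1`, `-1`,
`-1`. -/
structure IsLorentzBasis (Q : QuadraticForm ℝ V) (W : Submodule ℝ V) (u : Fin 3 → V) : Prop where
  span_eq : Submodule.span ℝ (Set.range u) = W
  apply_zero : Q (u 0) = 1
  apply_one : Q (u 1) = -1
  apply_two : Q (u 2) = -1
  bil_zero_one : bil Q (u 0) (u 1) = 0
  bil_zero_two : bil Q (u 0) (u 2) = 0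
  bil_one_two : bil Q (u 1) (u 2) = 0

theorem exists_isLorentzBasis {W : Submodule ℝ V} (h : HasSignature Q W 1 2) :
    ∃ u, IsLorentzBasis Q W u := by
  obtain ⟨hfin, hrank, hp, hq⟩ := h
  have h1 := QuadraticForm.equivalent_one_zero_neg_one_weighted_sum_squared (Q.restrict W)
  rw [hrank] at h1
  obtain ⟨w, hw, he⟩ := h1
  change Fin 3 → ℝ at w
  rw [QuadraticForm.sigPos_of_equiv_weightedSumSquares he] at hp
  rw [QuadraticForm.sigNeg_of_equiv_weightedSumSquares he] at hq
  obtain ⟨i₀, hi₀⟩ := Set.ncard_eq_one.1 hp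
  have hi₀' : 0 < w i₀ := by
    have : i₀ ∈ {i | 0 < w i} := hi₀ ▸ Set.mem_singleton i₀
    exact this
  -- One positive and two negative weights exhaust the three indices, so no weight is zero.
  have hneg : {i | w i < 0} = {i₀}ᶜ := by
    refine Set.eq_of_subset_of_ncard_le (fun i hi h => ?_) ?_ (Set.toFinite _)
    · rw [Set.mem_singleton_iff] at h
      subst h
      exact lt_asymm hi hi₀'
    · rw [hq, Set.ncard_compl, Set.ncard_singleton]
      simp
  have hw0 : w i₀ = 1 := by
    rcases hw i₀ with h | h | h
    · rw [h] at hi₀'; norm_num at hi₀'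
    · rw [h] at hi₀'; norm_num at hi₀'
    · exact h
  have hw1 : ∀ i, i ≠ i₀ → w i = -1 := fun i hi => by
    have h2 : i ∈ {i | w i < 0} := hneg ▸ hi
    have h2 : w i < 0 := h2
    rcases hw i with h | h | h
    · exact h
    · rw [h] at h2; norm_num at h2
    · rw [h] at h2; norm_num at h2
  obtain ⟨e⟩ := he
  -- The swap moves the positive direction to index `0`.
  let b : Module.Basis (Fin 3) ℝ W :=
    ((Pi.basisFun ℝ (Fin 3)).map e.toLinearEquiv.symm).reindex (Equiv.swap 0 i₀)
  have hb : ∀ i, e (b i) = Pi.single (Equiv.swap 0 i₀ i) 1 := fun i => by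
    simp only [b, Module.Basis.reindex_apply, Module.Basis.map_apply, Equiv.symm_swap,
      Pi.basisFun_apply]
    exact e.toLinearEquiv.apply_symm_apply _
  have hQ : ∀ x : W, Q x = ∑ i, w i * (e x i * e x i) := fun x => by
    have := e.map_app x
    rw [QuadraticMap.weightedSumSquares_apply] at this
    exact this.symm
  have hQb : ∀ i, Q (b i) = w (Equiv.swap 0 i₀ i) := fun i => by
    rw [hQ, hb]
    simp [Pi.single_apply]
  have hbb : ∀ i j, i ≠ j → bil Q (b i) (b j) = 0 := fun i j hij => by
    have h1 := map_add_eq Q (b i : V) (b j)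
    have h2 := hQ (b i + b j)
    have hij' : Equiv.swap 0 i₀ i ≠ Equiv.swap 0 i₀ j := fun h => hij (Equiv.injective _ h)
    have h3 : e (b i + b j) = Pi.single (Equiv.swap 0 i₀ i) 1 + Pi.single (Equiv.swap 0 i₀ j) 1 := by
      rw [← hb, ← hb]
      exact map_add e.toLinearEquiv _ _
    have h4 : Q ((b i : V) + b j) = w (Equiv.swap 0 i₀ i) + w (Equiv.swap 0 i₀ j) := by
      rw [← Submodule.coe_add, h2, h3]
      simp [Pi.single_apply, mul_add, Finset.sum_add_distrib, hij', hij'.symm]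
    rw [h4, hQb, hQb] at h1
    linarith
  have hne : ∀ i : Fin 3, i ≠ 0 → Equiv.swap 0 i₀ i ≠ i₀ := fun i hi h =>
    hi ((Equiv.swap 0 i₀).injective (h.trans (Equiv.swap_apply_left 0 i₀).symm))
  refine ⟨fun i => b i, ?_, ?_, ?_, ?_, hbb _ _ (by decide), hbb _ _ (by decide),
    hbb _ _ (by decide)⟩
  · have := congrArg (Submodule.map W.subtype) b.span_eq
    rwa [Submodule.map_span, Submodule.map_top, Submodule.range_subtype, ← Set.range_comp] at this
  · rw [hQb, Equiv.swap_apply_left, hw0]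
  · rw [hQb, hw1 _ (hne 1 (by decide))]
  · rw [hQb, hw1 _ (hne 2 (by decide))]

theorem sigPos_restrict_le {W W' : Submodule ℝ V} [Module.Finite ℝ W] [Module.Finite ℝ W']
    (h : W ≤ W') : sigPos (Q.restrict W) ≤ sigPos (Q.restrict W') := by
  obtain ⟨U, hU, hpos⟩ := exists_finrank_eq_sigPos_and_posDef (Q.restrict W)
  rw [← hU, (Submodule.equivMapOfInjective _ (Submodule.inclusion_injective h) U).finrank_eq]
  refine le_sigPos_of_posDef _ ?_
  rintro ⟨_, ⟨x, hx, rfl⟩⟩ hne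
  refine hpos ⟨x, hx⟩ fun h0 => hne ?_
  have : x = 0 := congrArg Subtype.val h0
  simp [this]

theorem one_le_sigPos_restrict {W : Submodule ℝ V} [Module.Finite ℝ W] {x : V} (hx : x ∈ W)
    (hpos : 0 < Q x) : 1 ≤ sigPos (Q.restrict W) := by
  have hx0 : (⟨x, hx⟩ : W) ≠ 0 := fun h => by
    have : x = 0 := congrArg Subtype.val h
    rw [this, QuadraticMap.map_zero] at hpos
    exact lt_irrefl _ hpos
  rw [← finrank_span_singleton (K := ℝ) hx0]
  refine le_sigPos_of_posDef _ ?_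
  rintro ⟨y, hy⟩ hne
  obtain ⟨c, rfl⟩ := Submodule.mem_span_singleton.1 hy
  have hc : c ≠ 0 := fun h => hne (by simp [h])
  change 0 < Q (c • x)
  rw [map_smul_eq]
  exact mul_pos (mul_self_pos.2 hc) hpos

/-- The Gram determinant of three vectors. -/
def gramDet (Q : QuadraticForm ℝ V) (v : Fin 3 → V) : ℝ :=
  (Matrix.of fun i j => bil Q (v i) (v j)).det

theorem gramDet_mem_polyAlgebra [Module.Finite ℝ V] (Q : QuadraticForm ℝ V) :
    gramDet Q ∈ polyAlgebra (Fin 3 → V) := by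
  have h : ∀ i j, (fun v : Fin 3 → V => bil Q (v i) (v j)) ∈ polyAlgebra (Fin 3 → V) :=
    fun i j => (IsPolyMap.bilinear (bil Q) (IsPolyMap.apply i) (IsPolyMap.apply j)).mem
  have h2 : gramDet Q = ∑ σ : Equiv.Perm (Fin 3),
      algebraMap ℝ ((Fin 3 → V) → ℝ) ((Equiv.Perm.sign σ : ℤ) : ℝ) *
        ∏ i, fun v : Fin 3 → V => bil Q (v (σ i)) (v i) := by
    ext v
    simp [gramDet, Matrix.det_apply', Finset.sum_apply, Finset.prod_apply]
  rw [h2]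
  exact Subalgebra.sum_mem _ fun σ _ => Subalgebra.mul_mem _ (Subalgebra.algebraMap_mem _ _)
    (Subalgebra.prod_mem _ fun i _ => h _ _)

theorem bil_sum_smul (v : Fin 3 → V) (c : Fin 3 → ℝ) (j : Fin 3) :
    bil Q (∑ i, c i • v i) (v j) =
      (Matrix.vecMul c (Matrix.of fun i j => bil Q (v i) (v j))) j := by
  simp only [map_sum, map_smul, LinearMap.sum_apply, LinearMap.smul_apply, smul_eq_mul,
    Matrix.vecMul, dotProduct, Matrix.of_apply]

/-- A vector in the left kernel of the Gram matrix is the coefficient vector of a combination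
orthogonal to every `v j`. This makes independence together with nondegeneracy a single polynomial
inequality, hence an open condition. -/
theorem gramDet_ne_zero_iff (v : Fin 3 → V) : gramDet Q v ≠ 0 ↔
    LinearIndependent ℝ v ∧ NondegenerateOn Q (Submodule.span ℝ (Set.range v)) := by
  constructor
  · intro h
    have key : ∀ c : Fin 3 → ℝ, (∀ j, bil Q (∑ i, c i • v i) (v j) = 0) → c = 0 := fun c hc =>
      Matrix.eq_zero_of_vecMul_eq_zero h (funext fun j => by rw [← bil_sum_smul, hc]; rfl)
    refine ⟨Fintype.linearIndependent_iff.2 fun c hc => ?_, fun z hz hzv => ?_⟩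
    · exact congrFun (key c fun j => by rw [hc]; simp)
    · obtain ⟨c, rfl⟩ := (Submodule.mem_span_range_iff_exists_fun ℝ).1 hz
      rw [key c fun j => hzv _ (Submodule.subset_span ⟨j, rfl⟩)]
      simp
  · rintro ⟨hli, hnd⟩ h0
    obtain ⟨c, hc, hc0⟩ := Matrix.exists_vecMul_eq_zero_iff.2 h0
    refine hc (funext (Fintype.linearIndependent_iff.1 hli c (hnd _ ?_ fun y hy => ?_)))
    · exact (Submodule.mem_span_range_iff_exists_fun ℝ).2 ⟨c, rfl⟩
    · have hle : Submodule.span ℝ (Set.range v) ≤ LinearMap.ker (bil Q (∑ i, c i • v i)) := by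
        rw [Submodule.span_le]
        rintro _ ⟨j, rfl⟩
        change bil Q (∑ i, c i • v i) (v j) = 0
        rw [bil_sum_smul, hc0]
        rfl
      exact hle hy

/-- In a space of signature `(1, d)`, three vectors with nonzero Gram determinant that have a
positive linear combination span a subspace of signature `(1, 2)`. -/
theorem hasSignature_span {V₁ : Submodule ℝ V} {d : ℕ} (hV₁ : HasSignature Q V₁ 1 d)
    {v : Fin 3 → V} (hv : ∀ i, v i ∈ V₁) (hg : gramDet Q v ≠ 0) {x : V}
    (hx : x ∈ Submodule.span ℝ (Set.range v)) (hpos : 0 < Q x) :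
    HasSignature Q (Submodule.span ℝ (Set.range v)) 1 2 := by
  obtain ⟨hli, hnd⟩ := (gramDet_ne_zero_iff v).1 hg
  obtain ⟨hfin, -, hp, -⟩ := hV₁
  have hrank : Module.finrank ℝ (Submodule.span ℝ (Set.range v)) = 3 := by
    rw [finrank_span_eq_card hli, Fintype.card_fin]
  have hle : Submodule.span ℝ (Set.range v) ≤ V₁ :=
    Submodule.span_le.2 (by rintro _ ⟨i, rfl⟩; exact hv i)
  have hfin' : Module.Finite ℝ (Submodule.span ℝ (Set.range v)) :=
    FiniteDimensional.span_of_finite ℝ (Set.finite_range v)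
  have h1 := one_le_sigPos_restrict hx hpos
  have h2 := sigPos_restrict_le (Q := Q) hle
  rw [hp] at h2
  have h3 : (Q.restrict (Submodule.span ℝ (Set.range v))).radical = ⊥ := by
    rw [Submodule.eq_bot_iff]
    rintro ⟨z, hz⟩ hzr
    rw [QuadraticMap.mem_radical_iff'] at hzr
    refine Subtype.ext (hnd z hz fun y hy => ?_)
    have h4 : Q (z + y) = Q y := hzr.2 ⟨y, hy⟩
    have h5 : Q z = 0 := hzr.1
    rw [map_add_eq, h5] at h4
    linarith
  have h6 := QuadraticForm.sigPos_add_sigNeg_add_radical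
    (Q := Q.restrict (Submodule.span ℝ (Set.range v)))
  rw [h3, finrank_bot, hrank] at h6
  exact ⟨hfin', hrank, by omega, by omega⟩

end Signature

/-! ### Unipotent one-parameter groups and their Lie algebras -/

section Nilpotent

variable {V : Type*} [AddCommGroup V] [Module ℝ V] {Q : QuadraticForm ℝ V}

theorem nilpotentExp_eq_sum {N : Module.End ℝ V} {n : ℕ} (hn : N ^ n = 0) :
    nilpotentExp N = ∑ i ∈ Finset.range n, ((i.factorial : ℝ)⁻¹) • N ^ i := by
  have hnil : IsNilpotent N := ⟨n, hn⟩
  refine Finset.sum_subset (Finset.range_subset_range.2 (Nat.sInf_le hn)) fun i _ hi => ?_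
  rw [pow_eq_zero_of_le (by simpa using hi) (pow_nilpotencyClass hnil), smul_zero]

/-- The exponential series of an endomorphism of cube zero. -/
noncomputable def quadExp (N : Module.End ℝ V) : Module.End ℝ V := 1 + N + (1 / 2 : ℝ) • N ^ 2

theorem quadExp_apply (N : Module.End ℝ V) (x : V) :
    quadExp N x = x + N x + (1 / 2 : ℝ) • N (N x) := by
  simp [quadExp, pow_two]

theorem nilpotentExp_eq_quadExp {N : Module.End ℝ V} (hN : N ^ 3 = 0) :
    nilpotentExp N = quadExp N := by
  rw [nilpotentExp_eq_sum hN, quadExp]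
  simp [Finset.sum_range_succ, Nat.factorial]

theorem isUnit_nilpotentExp {N : Module.End ℝ V} (hN : IsNilpotent N) :
    IsUnit (nilpotentExp N) := by
  obtain ⟨n, hn⟩ := hN
  have hn' : N ^ (n + 1) = 0 := by rw [pow_succ, hn, zero_mul]
  have h : nilpotentExp N =
      1 + N * ∑ i ∈ Finset.range n, (((i + 1).factorial : ℝ)⁻¹) • N ^ i := by
    rw [nilpotentExp_eq_sum hn', Finset.sum_range_succ', Finset.mul_sum, add_comm]
    simp [pow_succ']
  rw [h]
  refine IsNilpotent.isUnit_one_add (Commute.isNilpotent_mul_right ?_ ⟨n, hn⟩)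
  exact Commute.sum_right _ _ _ fun i _ => ((Commute.refl N).pow_right i).smul_right _

theorem quadraticForm_mem_polyAlgebra [Module.Finite ℝ V] (Q : QuadraticForm ℝ V) :
    (fun x => Q x) ∈ polyAlgebra V := by
  have h : (fun x => Q x) = fun x => (1 / 2 : ℝ) * bil Q x x := by
    ext x
    rw [bil_self]
    ring
  rw [h]
  exact mul_mem_polyAlgebra (const_mem_polyAlgebra _)
    (IsPolyMap.bilinear (bil Q) IsPolyMap.id IsPolyMap.id).mem

theorem isPolyMap_apply [Module.Finite ℝ V] {M : Type*} [AddCommGroup M] [Module ℝ M]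
    {φ : M → Module.End ℝ V} (hφ : IsPolyMap φ) (x : V) : IsPolyMap fun m => φ m x :=
  hφ.comp (IsPolyMap.linear (LinearMap.applyₗ x))

/-- The conditions that characterise the elements of the Lie algebra of `SO(W)`. -/
def IsInfinitesimalRotation (Q : QuadraticForm ℝ V) (W : Submodule ℝ V) (N : Module.End ℝ V) :
    Prop :=
  (∀ x, bil Q x (N x) = 0) ∧ ∀ x, (∀ w ∈ W, bil Q w x = 0) → N x = 0

theorem IsInfinitesimalRotation.bil_left {W : Submodule ℝ V} {N : Module.End ℝ V}
    (h : IsInfinitesimalRotation Q W N) (x y : V) : bil Q (N x) y = -bil Q x (N y) := by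
  have h1 := h.1 (x + y)
  rw [map_add, map_add, map_add, LinearMap.add_apply, LinearMap.add_apply, h.1, h.1,
    bil_comm Q y (N x)] at h1
  linarith

theorem IsInfinitesimalRotation.add {W : Submodule ℝ V} {N N' : Module.End ℝ V}
    (h : IsInfinitesimalRotation Q W N) (h' : IsInfinitesimalRotation Q W N') :
    IsInfinitesimalRotation Q W (N + N') :=
  ⟨fun x => by rw [LinearMap.add_apply, map_add, h.1, h'.1, add_zero],
    fun x hx => by rw [LinearMap.add_apply, h.2 x hx, h'.2 x hx, add_zero]⟩

theorem IsInfinitesimalRotation.smul {W : Submodule ℝ V} {N : Module.End ℝ V}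
    (h : IsInfinitesimalRotation Q W N) (c : ℝ) : IsInfinitesimalRotation Q W (c • N) :=
  ⟨fun x => by rw [LinearMap.smul_apply, map_smul, h.1, smul_zero],
    fun x hx => by rw [LinearMap.smul_apply, h.2 x hx, smul_zero]⟩

/-- Differentiation at `t = 0` done algebraically: `exp (tN) x = x + t (N x + t R)` with `R`
polynomial in `t`. Each condition is divided by `t ≠ 0` and then read off at `t = 0`. -/
theorem isInfinitesimalRotation_of_exp [Module.Finite ℝ V] {W : Submodule ℝ V}
    {H : Subgroup (LinearMap.GeneralLinearGroup ℝ V)} (hH : H ≤ specialOrthogonal Q W)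
    {N : Module.End ℝ V} (hN : IsNilpotent N)
    (hNH : ∀ g : LinearMap.GeneralLinearGroup ℝ V,
      g ∈ H ↔ ∃ t : ℝ, (g : Module.End ℝ V) = nilpotentExp (t • N)) :
    IsInfinitesimalRotation Q W N := by
  obtain ⟨n, hn⟩ := hN
  -- The shift by two ensures that the constant and linear terms can be split off even for small
  -- `n`.
  have hn' : N ^ (n + 2) = 0 := by rw [pow_add, hn, zero_mul]
  let R : ℝ → Module.End ℝ V := fun t =>
    ∑ i ∈ Finset.range n, (((i + 2).factorial : ℝ)⁻¹ * t ^ i) • N ^ (i + 2)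
  have hR : IsPolyMap R := IsPolyMap.sum _ fun i =>
    IsPolyMap.smul (mul_mem_polyAlgebra (const_mem_polyAlgebra _)
      (pow_mem_polyAlgebra IsPolyMap.id.mem i)) (IsPolyMap.const _)
  have hexp : ∀ (t : ℝ) (x : V), nilpotentExp (t • N) x = x + t • (N x + t • R t x) := fun t x => by
    rw [nilpotentExp_eq_sum (N := t • N) (n := n + 2) (by rw [smul_pow, hn', smul_zero]),
      Finset.sum_range_succ', Finset.sum_range_succ']
    simp only [R, LinearMap.add_apply, LinearMap.sum_apply, LinearMap.smul_apply, smul_add,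
      Finset.smul_sum, smul_smul, smul_pow]
    have : ∀ i : ℕ, ((i + 1 + 1).factorial : ℝ)⁻¹ * t ^ (i + 1 + 1) =
        t * (t * (((i + 2).factorial : ℝ)⁻¹ * t ^ i)) := fun i => by ring
    simp [this]
    abel
  have hmem : ∀ t : ℝ, ∃ g ∈ H, (g : Module.End ℝ V) = nilpotentExp (t • N) := fun t => by
    obtain ⟨g, hg⟩ := isUnit_nilpotentExp (N := t • N)
      ⟨n, by rw [smul_pow, hn, smul_zero]⟩
    exact ⟨g, (hNH g).2 ⟨t, hg⟩, hg⟩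
  refine ⟨fun x => ?_, fun x hx => ?_⟩
  · have hφ : IsPolyMap fun t : ℝ => bil Q x (R t x) + Q (N x + t • R t x) :=
      ((isPolyMap_apply hR x).comp (IsPolyMap.linear (bil Q x))).add
        (IsPolyMap.of_mem (((IsPolyMap.const (N x)).add (IsPolyMap.smul IsPolyMap.id.mem
          (isPolyMap_apply hR x))).comp_mem (quadraticForm_mem_polyAlgebra Q)))
    refine eq_zero_of_add_smul_eq_zero hφ fun t ht => ?_
    obtain ⟨g, hg, hgt⟩ := hmem t
    have h1 := (hH hg).1 x
    rw [hgt, hexp, map_add_eq, map_smul_eq, (bil Q x).map_smul, (bil Q x).map_add,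
      (bil Q x).map_smul] at h1
    simp only [smul_eq_mul] at h1 ⊢
    refine mul_left_cancel₀ ht ?_
    linarith
  · refine eq_zero_of_add_smul_eq_zero (isPolyMap_apply hR x) fun t ht => ?_
    obtain ⟨g, hg, hgt⟩ := hmem t
    have h1 := (hH hg).2.2 x fun u hu => isOrtho_iff_bil.2 (hx u hu)
    rw [hgt, hexp, add_eq_left, smul_eq_zero] at h1
    exact h1.resolve_left ht

theorem quadExp_mul {N : Module.End ℝ V} (hN : N ^ 3 = 0) (s t : ℝ) :
    quadExp (s • N) * quadExp (t • N) = quadExp ((s + t) • N) := by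
  have h3 : ∀ x, N (N (N x)) = 0 := fun x => by
    have := LinearMap.congr_fun hN x
    simpa [pow_succ] using this
  ext x
  simp only [Module.End.mul_apply, quadExp_apply, LinearMap.smul_apply, map_add, map_smul, h3,
    map_zero, smul_zero, add_zero]
  module

theorem quadExp_zero : quadExp (0 : Module.End ℝ V) = 1 := by
  simp [quadExp]

/-- The exponential of an endomorphism of cube zero, as a unit. -/
noncomputable def quadExpUnit {N : Module.End ℝ V} (hN : N ^ 3 = 0) : LinearMap.GeneralLinearGroup ℝ V where
  val := quadExp N
  inv := quadExp (-N)
  val_inv := by simpa [quadExp_zero] using quadExp_mul hN 1 (-1)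
  inv_val := by simpa [quadExp_zero] using quadExp_mul hN (-1) 1

/-- `quadExp N` is `1 - M` with `M` nilpotent, so its determinant is the characteristic polynomial
`X ^ n` of `M` evaluated at `1`. -/
theorem det_quadExp [Module.Finite ℝ V] {N : Module.End ℝ V} (hN : N ^ 3 = 0) :
    LinearMap.det (quadExp N) = 1 := by
  have hnil : IsNilpotent (-(N + (1 / 2 : ℝ) • N ^ 2)) := by
    have h : N + (1 / 2 : ℝ) • N ^ 2 = N * (1 + (1 / 2 : ℝ) • N) := by
      rw [mul_add, mul_one, mul_smul_comm, pow_two]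
    rw [h]
    refine IsNilpotent.neg (Commute.isNilpotent_mul_right ?_ ⟨3, hN⟩)
    exact (Commute.one_right _).add_right ((Commute.refl N).smul_right _)
  have h1 := LinearMap.eval_charpoly (-(N + (1 / 2 : ℝ) • N ^ 2)) 1
  rw [(LinearMap.charpoly_eq_X_pow_iff _).2 fun m => ?_] at h1
  · rw [Polynomial.eval_pow, Polynomial.eval_X, one_pow, map_one, sub_neg_eq_add, ← add_assoc]
      at h1
    exact h1.symm
  · obtain ⟨k, hk⟩ := hnil
    exact ⟨k, by rw [hk, LinearMap.zero_apply]⟩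

theorem IsInfinitesimalRotation.quadExp_mem [Module.Finite ℝ V] {W : Submodule ℝ V}
    {N : Module.End ℝ V} (h : IsInfinitesimalRotation Q W N) (hN : N ^ 3 = 0)
    {g : LinearMap.GeneralLinearGroup ℝ V} (hg : (g : Module.End ℝ V) = quadExp N) :
    g ∈ specialOrthogonal Q W := by
  have h3 : ∀ x, N (N (N x)) = 0 := fun x => by
    have := LinearMap.congr_fun hN x
    simpa [pow_succ] using this
  refine ⟨fun x => ?_, ?_, fun x hx => ?_⟩
  · have h1 : bil Q x (N (N x)) = -(2 * Q (N x)) := by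
      rw [← bil_self, h.bil_left, neg_neg]
    have h2 : Q (N (N x)) = 0 := by
      have := h.bil_left (N x) (N (N x))
      rw [bil_self, h3, map_zero] at this
      linarith
    rw [hg, quadExp_apply, map_add_eq, map_add_eq, map_smul_eq, h2, map_smul, map_add,
      LinearMap.add_apply, h1, h.1, h.1]
    simp only [smul_eq_mul]
    ring
  · rw [hg, det_quadExp hN]
  · have := h.2 x fun w hw => isOrtho_iff_bil.1 (hx w hw)
    rw [hg, quadExp_apply, this, map_zero, smul_zero, add_zero, add_zero]

theorem IsInfinitesimalRotation.span_mem [Module.Finite ℝ V] {W : Submodule ℝ V}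
    {N : Module.End ℝ V} (h : IsInfinitesimalRotation Q W N) (hN : N ^ 3 = 0) (h0 : N ≠ 0) :
    Submodule.span ℝ {N} ∈ unipotentDirections Q W := by
  have hN' : ∀ t : ℝ, (t • N) ^ 3 = 0 := fun t => by rw [smul_pow, hN, smul_zero]
  let H : Subgroup (LinearMap.GeneralLinearGroup ℝ V) :=
    { carrier := {g | ∃ t : ℝ, (g : Module.End ℝ V) = quadExp (t • N)}
      one_mem' := ⟨0, by rw [zero_smul, quadExp_zero, Units.val_one]⟩
      mul_mem' := by
        rintro g g' ⟨s, hs⟩ ⟨t, ht⟩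
        exact ⟨s + t, by rw [Units.val_mul, hs, ht, quadExp_mul hN]⟩
      inv_mem' := by
        rintro g ⟨t, ht⟩
        refine ⟨-t, Units.inv_eq_of_mul_eq_one_left ?_⟩
        rw [ht, quadExp_mul hN, neg_add_cancel, zero_smul, quadExp_zero] }
  refine ⟨H, ?_, N, h0, ⟨3, hN⟩, rfl, fun g => ?_⟩
  · rintro g ⟨t, ht⟩
    exact (h.smul t).quadExp_mem (hN' t) ht
  · simp only [nilpotentExp_eq_quadExp (hN' _)]
    rfl

/-- The endomorphism `e ∧ f` of the Lie algebra of the orthogonal group. -/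
def wedge (Q : QuadraticForm ℝ V) (e f : V) : Module.End ℝ V :=
  (bil Q e).smulRight f - (bil Q f).smulRight e

theorem wedge_apply (e f x : V) : wedge Q e f x = bil Q e x • f - bil Q f x • e := rfl

theorem isInfinitesimalRotation_wedge {W : Submodule ℝ V} {e f : V} (he : e ∈ W) (hf : f ∈ W) :
    IsInfinitesimalRotation Q W (wedge Q e f) :=
  ⟨fun x => by
    rw [wedge_apply, map_sub, map_smul, map_smul, bil_comm Q x f, bil_comm Q x e, smul_eq_mul,
      smul_eq_mul]
    ring,
  fun x hx => by rw [wedge_apply, hx e he, hx f hf, zero_smul, zero_smul, sub_zero]⟩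

theorem wedge_pow_three {e f : V} (he : Q e = 0) (hef : bil Q e f = 0) :
    wedge Q e f ^ 3 = 0 := by
  ext x
  simp only [pow_succ, pow_zero, one_mul, Module.End.mul_apply, wedge_apply, map_sub, map_smul,
    hef, bil_comm Q f e, bil_self, he]
  simp

/-- The bridge between unipotents and reflections: moving the mirror vector `f` in an isotropic
direction orthogonal to it changes the reflection by a unipotent isometry. -/
theorem quadExp_wedge {e f : V} (he : Q e = 0) (hef : bil Q e f = 0) (hf : Q f ≠ 0) :
    quadExp (wedge Q ((Q f)⁻¹ • e) f) =
      hyperplaneReflection Q f * hyperplaneReflection Q (f + e) := by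
  have hfe : Q (f + e) = Q f := by rw [map_add_eq, he, bil_comm, hef]; ring
  ext x
  simp only [Module.End.mul_apply, quadExp_apply, wedge_apply, hyperplaneReflection_apply,
    map_sub, map_smul, map_add, LinearMap.add_apply, LinearMap.smul_apply, smul_eq_mul,
    hfe, hef, bil_comm Q f e, bil_self, he]
  match_scalars <;> field_simp <;> ring

end Nilpotent

/-! ### The conic of nilpotent directions in a space of signature (1, 2) -/

section Lorentz

variable {V : Type*} [AddCommGroup V] [Module ℝ V] {Q : QuadraticForm ℝ V} {W : Submodule ℝ V}
  {u : Fin 3 → V}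

theorem IsLorentzBasis.mem (hu : IsLorentzBasis Q W u) (i : Fin 3) : u i ∈ W :=
  hu.span_eq ▸ Submodule.subset_span ⟨i, rfl⟩

theorem IsLorentzBasis.bil_zero_zero (hu : IsLorentzBasis Q W u) : bil Q (u 0) (u 0) = 2 := by
  rw [bil_self, hu.apply_zero, mul_one]

theorem IsLorentzBasis.bil_one_one (hu : IsLorentzBasis Q W u) : bil Q (u 1) (u 1) = -2 := by
  rw [bil_self, hu.apply_one, mul_neg_one]

theorem IsLorentzBasis.bil_two_two (hu : IsLorentzBasis Q W u) : bil Q (u 2) (u 2) = -2 := by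
  rw [bil_self, hu.apply_two, mul_neg_one]

theorem IsLorentzBasis.bil_one_zero (hu : IsLorentzBasis Q W u) : bil Q (u 1) (u 0) = 0 := by
  rw [bil_comm, hu.bil_zero_one]

theorem IsLorentzBasis.bil_two_zero (hu : IsLorentzBasis Q W u) : bil Q (u 2) (u 0) = 0 := by
  rw [bil_comm, hu.bil_zero_two]

theorem IsLorentzBasis.bil_two_one (hu : IsLorentzBasis Q W u) : bil Q (u 2) (u 1) = 0 := by
  rw [bil_comm, hu.bil_one_two]

theorem IsLorentzBasis.exists_coord (hu : IsLorentzBasis Q W u) {x : V} (hx : x ∈ W) :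
    ∃ c : Fin 3 → ℝ, x = c 0 • u 0 + c 1 • u 1 + c 2 • u 2 := by
  rw [← hu.span_eq] at hx
  obtain ⟨c, rfl⟩ := (Submodule.mem_span_range_iff_exists_fun ℝ).1 hx
  exact ⟨c, Fin.sum_univ_three _⟩

theorem IsLorentzBasis.exists_decomposition (hu : IsLorentzBasis Q W u) (x : V) :
    ∃ (c : Fin 3 → ℝ) (y : V), x = c 0 • u 0 + c 1 • u 1 + c 2 • u 2 + y ∧
      ∀ w ∈ W, bil Q w y = 0 := by
  let c : Fin 3 → ℝ := ![bil Q (u 0) x / 2, -(bil Q (u 1) x / 2), -(bil Q (u 2) x / 2)]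
  refine ⟨c, x - (c 0 • u 0 + c 1 • u 1 + c 2 • u 2), by abel, fun w hw => ?_⟩
  obtain ⟨a, rfl⟩ := hu.exists_coord hw
  simp only [c, Matrix.cons_val, map_sub, map_add, map_smul, LinearMap.add_apply,
    LinearMap.smul_apply, smul_eq_mul, hu.bil_zero_zero, hu.bil_one_one, hu.bil_two_two,
    hu.bil_zero_one, hu.bil_zero_two, hu.bil_one_two, hu.bil_one_zero, hu.bil_two_zero,
    hu.bil_two_one]
  ring

/-- The elements of the Lie algebra of `SO(W)` in the coordinates given by a Lorentz basis. -/
noncomputable def lorentzRotation (Q : QuadraticForm ℝ V) (u : Fin 3 → V) (a b c : ℝ) :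
    Module.End ℝ V :=
  (a / 2) • wedge Q (u 0) (u 1) + (b / 2) • wedge Q (u 0) (u 2) + (c / 2) • wedge Q (u 1) (u 2)

theorem lorentzRotation_apply (a b c : ℝ) (x : V) : lorentzRotation Q u a b c x =
    (a / 2) • (bil Q (u 0) x • u 1 - bil Q (u 1) x • u 0) +
      (b / 2) • (bil Q (u 0) x • u 2 - bil Q (u 2) x • u 0) +
        (c / 2) • (bil Q (u 1) x • u 2 - bil Q (u 2) x • u 1) := rfl

theorem IsLorentzBasis.isInfinitesimalRotation (hu : IsLorentzBasis Q W u) (a b c : ℝ) :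
    IsInfinitesimalRotation Q W (lorentzRotation Q u a b c) :=
  (((isInfinitesimalRotation_wedge (hu.mem 0) (hu.mem 1)).smul _).add
    ((isInfinitesimalRotation_wedge (hu.mem 0) (hu.mem 2)).smul _)).add
      ((isInfinitesimalRotation_wedge (hu.mem 1) (hu.mem 2)).smul _)

theorem IsLorentzBasis.lorentzRotation_zero (hu : IsLorentzBasis Q W u) (a b c : ℝ) :
    lorentzRotation Q u a b c (u 0) = a • u 1 + b • u 2 := by
  rw [lorentzRotation_apply, hu.bil_zero_zero, hu.bil_one_zero, hu.bil_two_zero]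
  module

theorem IsLorentzBasis.lorentzRotation_one (hu : IsLorentzBasis Q W u) (a b c : ℝ) :
    lorentzRotation Q u a b c (u 1) = a • u 0 - c • u 2 := by
  rw [lorentzRotation_apply, hu.bil_zero_one, hu.bil_one_one, hu.bil_two_one]
  module

theorem IsLorentzBasis.lorentzRotation_two (hu : IsLorentzBasis Q W u) (a b c : ℝ) :
    lorentzRotation Q u a b c (u 2) = b • u 0 + c • u 1 := by
  rw [lorentzRotation_apply, hu.bil_zero_two, hu.bil_one_two, hu.bil_two_two]
  module

/-- Cayley–Hamilton for a trace-free skew operator on a 3-space. It identifies the nilpotent cone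
with `a ^ 2 + b ^ 2 = c ^ 2`. -/
theorem IsLorentzBasis.lorentzRotation_pow_three (hu : IsLorentzBasis Q W u) (a b c : ℝ) :
    lorentzRotation Q u a b c ^ 3 = (a ^ 2 + b ^ 2 - c ^ 2) • lorentzRotation Q u a b c := by
  ext x
  simp only [pow_succ, pow_zero, one_mul, Module.End.mul_apply, LinearMap.smul_apply]
  rw [lorentzRotation_apply a b c x]
  simp only [map_add, map_sub, map_smul, hu.lorentzRotation_zero, hu.lorentzRotation_one,
    hu.lorentzRotation_two]
  module

theorem IsLorentzBasis.lorentzRotation_ne_zero (hu : IsLorentzBasis Q W u) {a b c : ℝ}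
    (hc : c ≠ 0) : lorentzRotation Q u a b c ≠ 0 := by
  intro h
  have h1 := congrArg (bil Q (u 1)) (hu.lorentzRotation_two a b c)
  rw [h, LinearMap.zero_apply, map_zero, map_add, map_smul, map_smul, hu.bil_one_zero,
    hu.bil_one_one, smul_eq_mul, smul_eq_mul] at h1
  apply hc
  linarith

/-- The three coefficients are read off from pairings with the basis. The difference `D` is skew,
kills the complement of `W` and pairs to zero on the basis, so it vanishes by nondegeneracy. -/
theorem IsLorentzBasis.exists_eq_lorentzRotation (hu : IsLorentzBasis Q W u)
    (hQ : NondegenerateOn Q ⊤) {N : Module.End ℝ V} (hN : IsInfinitesimalRotation Q W N) :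
    ∃ a b c, N = lorentzRotation Q u a b c := by
  refine ⟨-(bil Q (N (u 0)) (u 1) / 2), -(bil Q (N (u 0)) (u 2) / 2),
    -(bil Q (N (u 2)) (u 1) / 2), ?_⟩
  set L := lorentzRotation Q u (-(bil Q (N (u 0)) (u 1) / 2)) (-(bil Q (N (u 0)) (u 2) / 2))
    (-(bil Q (N (u 2)) (u 1) / 2)) with hL
  have hL' : IsInfinitesimalRotation Q W L := hu.isInfinitesimalRotation _ _ _
  have hD : IsInfinitesimalRotation Q W (N + (-1 : ℝ) • L) := hN.add (hL'.smul _)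
  set D := N + (-1 : ℝ) • L with hDdef
  have h01 : bil Q (D (u 0)) (u 1) = 0 := by
    rw [hDdef, hL, LinearMap.add_apply, LinearMap.smul_apply, hu.lorentzRotation_zero]
    simp only [map_add, map_smul, LinearMap.add_apply, LinearMap.smul_apply, smul_eq_mul,
      hu.bil_one_one, hu.bil_two_one]
    ring
  have h02 : bil Q (D (u 0)) (u 2) = 0 := by
    rw [hDdef, hL, LinearMap.add_apply, LinearMap.smul_apply, hu.lorentzRotation_zero]
    simp only [map_add, map_smul, LinearMap.add_apply, LinearMap.smul_apply, smul_eq_mul,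
      hu.bil_two_two, hu.bil_one_two]
    ring
  have h21 : bil Q (D (u 2)) (u 1) = 0 := by
    rw [hDdef, hL, LinearMap.add_apply, LinearMap.smul_apply, hu.lorentzRotation_two]
    simp only [map_add, map_smul, LinearMap.add_apply, LinearMap.smul_apply, smul_eq_mul,
      hu.bil_one_one, hu.bil_zero_one]
    ring
  have h10 : bil Q (D (u 1)) (u 0) = 0 := by rw [hD.bil_left, bil_comm, h01, neg_zero]
  have h20 : bil Q (D (u 2)) (u 0) = 0 := by rw [hD.bil_left, bil_comm, h02, neg_zero]
  have h12 : bil Q (D (u 1)) (u 2) = 0 := by rw [hD.bil_left, bil_comm, h21, neg_zero]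
  have hdiag : ∀ x, bil Q (D x) x = 0 := fun x => by rw [bil_comm]; exact hD.1 x
  have hD0 : D = 0 := by
    ext x
    refine hQ _ trivial fun y _ => ?_
    obtain ⟨c, x', rfl, hx'⟩ := hu.exists_decomposition x
    obtain ⟨c', y', rfl, hy'⟩ := hu.exists_decomposition y
    have hy : ∀ z, bil Q (D z) y' = 0 := fun z => by
      rw [hD.bil_left, hD.2 y' hy', map_zero, neg_zero]
    simp only [map_add, map_smul, LinearMap.add_apply, LinearMap.smul_apply, hD.2 x' hx', hy,
      h01, h02, h21, h10, h20, h12, hdiag, smul_zero, add_zero]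
  have : N = D + L := by rw [hDdef]; module
  rw [this, hD0, zero_add]

/-- The parametrisation of the nilpotent elements of the Lie algebra of `SO(W)`. -/
noncomputable def lorentzNilpotent (Q : QuadraticForm ℝ V) (u : Fin 3 → V) (z : ℝ × ℝ) :
    Module.End ℝ V :=
  lorentzRotation Q u (z.1 ^ 2 - z.2 ^ 2) (2 * z.1 * z.2) (z.1 ^ 2 + z.2 ^ 2)

theorem sq_add_sq_mem_polyAlgebra : (fun z : ℝ × ℝ => z.1 ^ 2 + z.2 ^ 2) ∈ polyAlgebra (ℝ × ℝ) :=
  add_mem_polyAlgebra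
    (pow_mem_polyAlgebra (dual_mem_polyAlgebra (LinearMap.fst ℝ ℝ ℝ)) 2)
    (pow_mem_polyAlgebra (dual_mem_polyAlgebra (LinearMap.snd ℝ ℝ ℝ)) 2)

theorem isPolyMap_lorentzNilpotent (Q : QuadraticForm ℝ V) (u : Fin 3 → V) :
    IsPolyMap (lorentzNilpotent Q u) := by
  have h1 : (fun z : ℝ × ℝ => z.1) ∈ polyAlgebra (ℝ × ℝ) :=
    dual_mem_polyAlgebra (LinearMap.fst ℝ ℝ ℝ)
  have h2 : (fun z : ℝ × ℝ => z.2) ∈ polyAlgebra (ℝ × ℝ) :=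
    dual_mem_polyAlgebra (LinearMap.snd ℝ ℝ ℝ)
  have ha : (fun z : ℝ × ℝ => (z.1 ^ 2 - z.2 ^ 2) / 2) ∈ polyAlgebra (ℝ × ℝ) := by
    convert mul_mem_polyAlgebra (const_mem_polyAlgebra (1 / 2)) (add_mem_polyAlgebra
      (pow_mem_polyAlgebra h1 2) (mul_mem_polyAlgebra (const_mem_polyAlgebra (-1))
        (pow_mem_polyAlgebra h2 2))) using 2
    ring
  have hb : (fun z : ℝ × ℝ => (2 * z.1 * z.2) / 2) ∈ polyAlgebra (ℝ × ℝ) := by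
    convert mul_mem_polyAlgebra h1 h2 using 2
    ring
  have hc : (fun z : ℝ × ℝ => (z.1 ^ 2 + z.2 ^ 2) / 2) ∈ polyAlgebra (ℝ × ℝ) := by
    convert mul_mem_polyAlgebra (const_mem_polyAlgebra (1 / 2)) sq_add_sq_mem_polyAlgebra using 2
    ring
  exact ((IsPolyMap.smul ha (IsPolyMap.const _)).add (IsPolyMap.smul hb (IsPolyMap.const _))).add
    (IsPolyMap.smul hc (IsPolyMap.const _))

theorem IsLorentzBasis.lorentzNilpotent_pow_three (hu : IsLorentzBasis Q W u) (z : ℝ × ℝ) :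
    lorentzNilpotent Q u z ^ 3 = 0 := by
  rw [lorentzNilpotent, hu.lorentzRotation_pow_three]
  convert zero_smul ℝ _ using 2
  ring

theorem IsLorentzBasis.span_lorentzNilpotent_mem [Module.Finite ℝ V] (hu : IsLorentzBasis Q W u)
    {z : ℝ × ℝ} (hz : 0 < z.1 ^ 2 + z.2 ^ 2) :
    Submodule.span ℝ {lorentzNilpotent Q u z} ∈ unipotentDirections Q W :=
  (hu.isInfinitesimalRotation _ _ _).span_mem (hu.lorentzNilpotent_pow_three z)
    (hu.lorentzRotation_ne_zero hz.ne')

/-- `z` is a complex square root of `a + ib`, and `c` is its squared modulus. The half-angle formula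
for it divides by zero when `a = -c`, which is treated apart. -/
theorem exists_conic_parameter {a b c : ℝ} (hc : 0 < c) (h : a ^ 2 + b ^ 2 = c ^ 2) :
    ∃ z : ℝ × ℝ, a = z.1 ^ 2 - z.2 ^ 2 ∧ b = 2 * z.1 * z.2 ∧ c = z.1 ^ 2 + z.2 ^ 2 := by
  have hac : 0 ≤ c + a := by
    have := abs_le_of_sq_le_sq (a := a) (b := c) (by linarith [sq_nonneg b]) hc.le
    linarith [neg_abs_le a]
  rcases hac.eq_or_lt with h0 | h0
  · have ha : a = -c := by linarith
    have hb : b = 0 := by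
      rw [ha] at h
      exact pow_eq_zero_iff two_ne_zero |>.1 (by linarith)
    refine ⟨(0, √c), ?_, ?_, ?_⟩ <;> simp [ha, hb, Real.sq_sqrt hc.le]
  · have hs : √((c + a) / 2) ^ 2 = (c + a) / 2 := Real.sq_sqrt (by positivity)
    have hs0 : √((c + a) / 2) ≠ 0 := (Real.sqrt_pos.2 (by positivity)).ne'
    have ht : (b / (2 * √((c + a) / 2))) ^ 2 = (c - a) / 2 := by
      rw [div_pow, mul_pow, hs]
      field_simp
      linarith
    refine ⟨(√((c + a) / 2), b / (2 * √((c + a) / 2))), ?_, ?_, ?_⟩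
    · rw [hs, ht]; ring
    · field_simp
    · rw [hs, ht]; ring

theorem eq_zero_of_isNilpotent_of_pow_three {N : Module.End ℝ V} (hN : IsNilpotent N)
    (h0 : N ≠ 0) {k : ℝ} (h : N ^ 3 = k • N) : k = 0 := by
  obtain ⟨n, hn⟩ := hN
  have key : ∀ m : ℕ, N ^ (2 * m + 1) = k ^ m • N := fun m => by
    induction m with
    | zero => simp
    | succ m ih =>
      have : 2 * (m + 1) + 1 = (2 * m + 1) + 2 := by ring
      rw [this, pow_add, ih, smul_mul_assoc, ← pow_succ', h, smul_smul, pow_succ]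
  have h1 := key n
  rw [show 2 * n + 1 = n + (n + 1) by ring, pow_add, hn, zero_mul] at h1
  exact eq_zero_of_pow_eq_zero ((smul_eq_zero.1 h1.symm).resolve_right h0)

theorem IsLorentzBasis.exists_span_eq [Module.Finite ℝ V] (hu : IsLorentzBasis Q W u)
    (hQ : NondegenerateOn Q ⊤) {L : Submodule ℝ (Module.End ℝ V)}
    (hL : L ∈ unipotentDirections Q W) :
    ∃ z : ℝ × ℝ, 0 < z.1 ^ 2 + z.2 ^ 2 ∧ L = Submodule.span ℝ {lorentzNilpotent Q u z} := by
  obtain ⟨H, hH, N, h0, hnil, rfl, hNH⟩ := hL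
  obtain ⟨a, b, c, rfl⟩ := hu.exists_eq_lorentzRotation hQ
    (isInfinitesimalRotation_of_exp hH hnil hNH)
  have hk := eq_zero_of_isNilpotent_of_pow_three hnil h0 (hu.lorentzRotation_pow_three a b c)
  have hc : c ≠ 0 := by
    rintro rfl
    have ha : a = 0 := by nlinarith
    have hb : b = 0 := by nlinarith
    apply h0
    simp [lorentzRotation, ha, hb]
  -- The parametrisation covers only `c > 0`; for `c < 0` the generator `-N` of the same line is
  -- used.
  rcases lt_or_gt_of_ne hc with hc | hc
  · obtain ⟨z, h1, h2, h3⟩ := exists_conic_parameter (a := -a) (b := -b) (c := -c)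
      (by linarith) (by linarith)
    refine ⟨z, by linarith, ?_⟩
    rw [lorentzNilpotent, ← h1, ← h2, ← h3, ← Submodule.span_neg, Set.neg_singleton]
    congr 2
    simp only [lorentzRotation]
    module
  · obtain ⟨z, h1, h2, h3⟩ := exists_conic_parameter (a := a) (b := b) (c := c) hc (by linarith)
    refine ⟨z, by linarith, ?_⟩
    rw [lorentzNilpotent, ← h1, ← h2, ← h3]

/-- A segment between the parameters `z` and `z'` gives a polynomial curve on the cone. It may cross
`z = 0`, where the nilpotent vanishes, but not near `t = 0` nor at `t = 1`. -/
theorem IsLorentzBasis.lineConnected [Module.Finite ℝ V] (hu : IsLorentzBasis Q W u)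
    (hQ : NondegenerateOn Q ⊤) : LineConnected 1 (unipotentDirections Q W) := by
  intro L hL L' hL'
  obtain ⟨z, hz, rfl⟩ := hu.exists_span_eq hQ hL
  obtain ⟨z', hz', rfl⟩ := hu.exists_span_eq hQ hL'
  refine ⟨fun t _ => lorentzNilpotent Q u (z + t • (z' - z)),
    IsPolyMap.pi fun _ => (IsPolyMap.line z z').comp (isPolyMap_lorentzNilpotent Q u), ?_, ?_, ?_,
    ?_⟩
  · simp
  · rw [linearIndependent_unique_iff]
    simpa [lorentzNilpotent] using hu.lorentzRotation_ne_zero hz'.ne'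
  · simp
  · filter_upwards [eventually_pos_line sq_add_sq_mem_polyAlgebra z' hz] with t ht
    refine ⟨?_, ?_⟩
    · rw [linearIndependent_unique_iff]
      exact hu.lorentzRotation_ne_zero ht.ne'
    · rw [Set.range_const]
      exact hu.span_lorentzNilpotent_mem ht

theorem pow_three_eq_zero_of_mem [Module.Finite ℝ V] (hu : IsLorentzBasis Q W u)
    (hQ : NondegenerateOn Q ⊤) {L : Submodule ℝ (Module.End ℝ V)}
    (hL : L ∈ unipotentDirections Q W) {N : Module.End ℝ V} (hN : N ∈ L) : N ^ 3 = 0 := by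
  obtain ⟨z, hz, rfl⟩ := hu.exists_span_eq hQ hL
  obtain ⟨t, rfl⟩ := Submodule.mem_span_singleton.1 hN
  rw [smul_pow, hu.lorentzNilpotent_pow_three, smul_zero]

end Lorentz

/-! ### Products of two reflections generated by unipotents -/

section Reflections

variable {V : Type*} [AddCommGroup V] [Module ℝ V] {Q : QuadraticForm ℝ V} {W : Submodule ℝ V}
  {u : Fin 3 → V}

theorem reflection_mul_mem_of_isotropic [Module.Finite ℝ V]
    {S : Subgroup (LinearMap.GeneralLinearGroup ℝ V)}
    (hS : ∀ L ∈ unipotentDirections Q W, ∀ N ∈ L, ∀ g : LinearMap.GeneralLinearGroup ℝ V,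
      (g : Module.End ℝ V) = quadExp N → g ∈ S)
    {e f : V} (he : e ∈ W) (hf : f ∈ W) (hQe : Q e = 0) (hef : bil Q e f = 0) (hQf : Q f ≠ 0)
    (hQfe : Q (f + e) ≠ 0) : reflectionUnit Q hQf * reflectionUnit Q hQfe ∈ S := by
  have hg : ((reflectionUnit Q hQf * reflectionUnit Q hQfe : LinearMap.GeneralLinearGroup ℝ V) :
      Module.End ℝ V) = quadExp (wedge Q ((Q f)⁻¹ • e) f) := by
    rw [quadExp_wedge hQe hef hQf]
    rfl
  by_cases h0 : wedge Q ((Q f)⁻¹ • e) f = 0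
  · rw [h0, quadExp_zero] at hg
    rw [Units.ext (hg.trans Units.val_one.symm)]
    exact S.one_mem
  · refine hS _ ((isInfinitesimalRotation_wedge (W.smul_mem _ he) hf).span_mem
      (wedge_pow_three ?_ ?_) h0) _ (Submodule.mem_span_singleton_self _) _ hg
    · rw [map_smul_eq, hQe, mul_zero]
    · rw [map_smul, LinearMap.smul_apply, hef, smul_zero]

/-- The Lorentzian cross product of `x` and `y`. -/
theorem IsLorentzBasis.exists_normal (hu : IsLorentzBasis Q W u) {x y : V} (hx : x ∈ W)
    (hy : y ∈ W) : ∃ n ∈ W, bil Q n x = 0 ∧ bil Q n y = 0 ∧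
      Q n = Q x * Q y - (bil Q x y / 2) ^ 2 := by
  obtain ⟨a, rfl⟩ := hu.exists_coord hx
  obtain ⟨b, rfl⟩ := hu.exists_coord hy
  refine ⟨(a 1 * b 2 - a 2 * b 1) • u 0 + (a 0 * b 2 - a 2 * b 0) • u 1 +
    (a 1 * b 0 - a 0 * b 1) • u 2, W.add_mem (W.add_mem (W.smul_mem _ (hu.mem _))
      (W.smul_mem _ (hu.mem _))) (W.smul_mem _ (hu.mem _)), ?_, ?_, ?_⟩ <;>
  simp only [map_add_eq, map_smul_eq, map_add, map_smul, LinearMap.add_apply,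
    LinearMap.smul_apply, smul_eq_mul, hu.bil_zero_zero, hu.bil_one_one, hu.bil_two_two,
    hu.bil_zero_one, hu.bil_zero_two, hu.bil_one_two, hu.bil_one_zero, hu.bil_two_zero,
    hu.bil_two_one, hu.apply_zero, hu.apply_one, hu.apply_two] <;>
  ring

theorem reflectionUnit_congr {x y : V} (hx : Q x ≠ 0) (hy : Q y ≠ 0)
    (h : hyperplaneReflection Q x = hyperplaneReflection Q y) :
    reflectionUnit Q hx = reflectionUnit Q hy := Units.ext h

/-- The quadric `Q = -1` in `W` is a doubly ruled hyperboloid of one sheet. Unless `bil Q x y = 2`,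
the witness `w` joins `x` and `y` by two isotropic moves, and each move costs one unipotent factor.
-/
theorem IsLorentzBasis.reflection_mul_mem_of_neg_one [Module.Finite ℝ V]
    (hu : IsLorentzBasis Q W u) {S : Subgroup (LinearMap.GeneralLinearGroup ℝ V)}
    (hS : ∀ L ∈ unipotentDirections Q W, ∀ N ∈ L, ∀ g : LinearMap.GeneralLinearGroup ℝ V,
      (g : Module.End ℝ V) = quadExp N → g ∈ S)
    {x y : V} (hx : x ∈ W) (hy : y ∈ W) (hQx : Q x = -1) (hQy : Q y = -1)
    (hxy : bil Q x y ≠ 2) (hx0 : Q x ≠ 0) (hy0 : Q y ≠ 0) :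
    reflectionUnit Q hx0 * reflectionUnit Q hy0 ∈ S := by
  obtain ⟨n, hn, hnx, hny, hQn⟩ := hu.exists_normal hx hy
  have hc : 2 - bil Q x y ≠ 0 := fun h => hxy (by linarith)
  -- the point `w` of the hyperboloid lies on ruling lines through `x` and `y`
  set w := (2 / (2 - bil Q x y)) • (x + y + n) with hw
  have hwW : w ∈ W := W.smul_mem _ (W.add_mem (W.add_mem hx hy) hn)
  have hQw : Q w = -1 := by
    rw [hw, map_smul_eq, map_add_eq, map_add_eq, hQx, hQy, hQn, hQx, hQy, map_add,
      LinearMap.add_apply, bil_comm Q x n, bil_comm Q y n, hnx, hny]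
    field_simp
    ring
  have hwx : bil Q w x = -2 := by
    rw [hw, map_smul, LinearMap.smul_apply, map_add, map_add, LinearMap.add_apply,
      LinearMap.add_apply, hnx, bil_self, hQx, bil_comm Q y x, smul_eq_mul]
    field_simp
    ring
  have hwy : bil Q w y = -2 := by
    rw [hw, map_smul, LinearMap.smul_apply, map_add, map_add, LinearMap.add_apply,
      LinearMap.add_apply, hny, bil_self, hQy, smul_eq_mul]
    field_simp
    ring
  have hw0 : Q w ≠ 0 := by rw [hQw]; norm_num
  clear_value w
  have key : ∀ z ∈ W, ∀ hz0 : Q z ≠ 0, Q z = -1 → bil Q w z = -2 →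
      reflectionUnit Q hz0 * reflectionUnit Q hw0 ∈ S := by
    intro z hz hz0 hQz hwz
    have h1 : z + (w + (-1 : ℝ) • z) = w := by module
    have h2 : Q (z + (w + (-1 : ℝ) • z)) ≠ 0 := by rwa [h1]
    have := reflection_mul_mem_of_isotropic hS (e := w + (-1 : ℝ) • z) (f := z)
      (W.add_mem hwW (W.smul_mem _ hz)) hz
      (by rw [map_add_eq, map_smul_eq, (bil Q w).map_smul, hwz, hQw, hQz, smul_eq_mul]; norm_num)
      (by rw [map_add, map_smul, LinearMap.add_apply, LinearMap.smul_apply, bil_self, hwz, hQz,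
        smul_eq_mul]; norm_num) hz0 h2
    rwa [reflectionUnit_congr h2 hw0 (by rw [h1])] at this
  have h1 := S.mul_mem (key x hx hx0 hQx hwx) (S.inv_mem (key y hy hy0 hQy hwy))
  have hyy : (reflectionUnit Q hy0)⁻¹ = reflectionUnit Q hy0 :=
    inv_eq_of_mul_eq_one_left (reflectionUnit_mul_self Q hy0)
  rwa [mul_inv_rev, hyy, mul_assoc, mul_inv_cancel_left] at h1

/-- Rescaling to `Q = -1` does not change reflections, and the strict inequality excludes the bad
value `2`. The hypotheses are open in `(x, y)`, which suffices for a later polynomial continuation.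
-/
theorem IsLorentzBasis.reflection_mul_mem [Module.Finite ℝ V]
    (hu : IsLorentzBasis Q W u) {S : Subgroup (LinearMap.GeneralLinearGroup ℝ V)}
    (hS : ∀ L ∈ unipotentDirections Q W, ∀ N ∈ L, ∀ g : LinearMap.GeneralLinearGroup ℝ V,
      (g : Module.End ℝ V) = quadExp N → g ∈ S)
    {x y : V} (hx : x ∈ W) (hy : y ∈ W) (hQx : Q x < 0) (hQy : Q y < 0)
    (hxy : bil Q x y ^ 2 < 4 * Q x * Q y) (hx0 : Q x ≠ 0) (hy0 : Q y ≠ 0) :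
    reflectionUnit Q hx0 * reflectionUnit Q hy0 ∈ S := by
  have hr : ∀ z, Q z < 0 → √(-Q z) ≠ 0 ∧ √(-Q z) ^ 2 = -Q z := fun z hz =>
    ⟨(Real.sqrt_pos.2 (by linarith)).ne', Real.sq_sqrt (by linarith)⟩
  obtain ⟨hrx, hrx2⟩ := hr x hQx
  obtain ⟨hry, hry2⟩ := hr y hQy
  have hn : ∀ z, Q z < 0 → Q ((√(-Q z))⁻¹ • z) = -1 := fun z hz => by
    obtain ⟨h1, h2⟩ := hr z hz
    rw [map_smul_eq, ← mul_inv, ← pow_two, h2]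
    have := hz.ne
    field_simp
  have h1 := hn x hQx
  have h2 := hn y hQy
  have h1' : Q ((√(-Q x))⁻¹ • x) ≠ 0 := by rw [h1]; norm_num
  have h2' : Q ((√(-Q y))⁻¹ • y) ≠ 0 := by rw [h2]; norm_num
  have := hu.reflection_mul_mem_of_neg_one hS (W.smul_mem (√(-Q x))⁻¹ hx)
    (W.smul_mem (√(-Q y))⁻¹ hy) h1 h2 (fun h => by
      rw [map_smul, map_smul, LinearMap.smul_apply, smul_eq_mul, smul_eq_mul] at h
      have h3 : bil Q x y = 2 * √(-Q x) * √(-Q y) := by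
        field_simp at h
        linarith
      rw [h3, mul_pow, mul_pow, hrx2, hry2] at hxy
      linarith) h1' h2'
  rwa [reflectionUnit_congr h1' hx0 (hyperplaneReflection_smul Q _ (inv_ne_zero hrx) x),
    reflectionUnit_congr h2' hy0 (hyperplaneReflection_smul Q _ (inv_ne_zero hry) y)] at this

/-- The condition that a polynomial function vanishes at a product of two reflections is a
polynomial condition on the two vectors. -/
theorem exists_reflection_polynomial [Module.Finite ℝ V] (Q : QuadraticForm ℝ V)
    {f : Module.End ℝ V → ℝ} (hf : f ∈ polyAlgebra (Module.End ℝ V)) :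
    ∃ p ∈ polyAlgebra (V × V), ∀ x y, p (x, y) = 0 ↔
      (Q x ≠ 0 → Q y ≠ 0 → f (hyperplaneReflection Q x * hyperplaneReflection Q y) = 0) := by
  have hfst : IsPolyMap fun z : V × V => z.1 := IsPolyMap.linear (LinearMap.fst ℝ V V)
  have hsnd : IsPolyMap fun z : V × V => z.2 := IsPolyMap.linear (LinearMap.snd ℝ V V)
  -- The reflection multiplied by its denominator `Q x`.
  let R : V → Module.End ℝ V := fun x => Q x • 1 - LinearMap.smulRightₗ (bil Q x) x
  have hR : IsPolyMap R := (IsPolyMap.smul (quadraticForm_mem_polyAlgebra Q)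
    (IsPolyMap.const _)).sub (IsPolyMap.bilinear LinearMap.smulRightₗ
      (IsPolyMap.linear (bil Q)) IsPolyMap.id)
  have hRr : ∀ x, Q x ≠ 0 → R x = Q x • hyperplaneReflection Q x := fun x hx => by
    ext y
    change Q x • y - bil Q x y • x = Q x • hyperplaneReflection Q x y
    rw [hyperplaneReflection_apply, smul_sub, smul_smul, mul_inv_cancel_left₀ hx]
  have hD : (fun z : V × V => Q z.1 * Q z.2) ∈ polyAlgebra (V × V) :=
    mul_mem_polyAlgebra (hfst.comp_mem (quadraticForm_mem_polyAlgebra Q))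
      (hsnd.comp_mem (quadraticForm_mem_polyAlgebra Q))
  obtain ⟨p, hp, k, hpk⟩ := exists_clear_denominator hD
    ((hfst.comp hR).mul (hsnd.comp hR)) hf
  -- The extra factor `Q x * Q y` makes the polynomial vanish at isotropic vectors, where the
  -- right-hand side holds vacuously.
  refine ⟨_, mul_mem_polyAlgebra hD hp, fun x y => ?_⟩
  by_cases hx : Q x = 0
  · simp [hx]
  by_cases hy : Q y = 0
  · simp [hy]
  have h1 : (Q x * Q y)⁻¹ • (R x * R y) =
      hyperplaneReflection Q x * hyperplaneReflection Q y := by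
    rw [hRr x hx, hRr y hy, smul_mul_smul_comm, smul_smul, inv_mul_cancel₀ (mul_ne_zero hx hy),
      one_smul]
  have h2 := hpk (x, y) (mul_ne_zero hx hy)
  dsimp only at h2 ⊢
  rw [h1] at h2
  rw [h2]
  simp [hx, hy]

end Reflections

/-! ### The space of admissible subspaces `W` -/

section Lines

variable {V : Type*} [AddCommGroup V] [Module ℝ V] {Q : QuadraticForm ℝ V}

/-- The space of subspaces of signature `(1, 2)` between `P` and `V₁`. -/
def lorentzSubspaces (Q : QuadraticForm ℝ V) (P V₁ : Submodule ℝ V) : Set (Submodule ℝ V) :=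
  {W | P ≤ W ∧ W ≤ V₁ ∧ HasSignature Q W 1 2}

theorem exists_basis_of_mem_lorentzSubspaces {P V₁ W : Submodule ℝ V} {p : V} (hp : p ≠ 0)
    (hpP : p ∈ P) (hW : W ∈ lorentzSubspaces Q P V₁) :
    ∃ v : Fin 3 → V, v 2 = p ∧ LinearIndependent ℝ v ∧
      Submodule.span ℝ (Set.range v) = W := by
  obtain ⟨hPW, -, hfin, hrank, -⟩ := hW
  have h1 : LinearIndependent ℝ ![(⟨p, hPW hpP⟩ : W)] := by
    rw [linearIndependent_unique_iff]
    exact fun h => hp (congrArg Subtype.val h)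
  obtain ⟨y, hy⟩ := exists_linearIndependent_cons_of_lt_finrank h1 (by omega)
  obtain ⟨x, hx⟩ := exists_linearIndependent_cons_of_lt_finrank hy (by omega)
  have hspan := hx.span_eq_top_of_card_eq_finrank' (by rw [hrank]; rfl)
  refine ⟨W.subtype ∘ Fin.cons x (Fin.cons y ![⟨p, hPW hpP⟩]), rfl,
    hx.map' _ (Submodule.ker_subtype W), ?_⟩
  have := congrArg (Submodule.map W.subtype) hspan
  rwa [Submodule.map_span, Submodule.map_top, Submodule.range_subtype, ← Set.range_comp] at this

/-- Admissibility near `v` amounts to a nonzero Gram determinant and a positive vector, both open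
along the line. The target `v'` may be linearly dependent, so it can contain arbitrary vectors of
`V₁`. -/
theorem eventually_span_mem_lorentzSubspaces [Module.Finite ℝ V] {P V₁ W : Submodule ℝ V} {d : ℕ}
    (hV₁ : HasSignature Q V₁ 1 d) {p : V} (hpP : P = Submodule.span ℝ {p})
    (hW : W ∈ lorentzSubspaces Q P V₁) {v v' : Fin 3 → V} (hv2 : v 2 = p)
    (hli : LinearIndependent ℝ v) (hspan : Submodule.span ℝ (Set.range v) = W)
    (hv'2 : v' 2 = p) (hv' : ∀ i, v' i ∈ V₁) :
    ∀ᶠ t in nhds (0 : ℝ), LinearIndependent ℝ (v + t • (v' - v)) ∧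
      Submodule.span ℝ (Set.range (v + t • (v' - v))) ∈ lorentzSubspaces Q P V₁ := by
  obtain ⟨hPW, hWV₁, hsig⟩ := hW
  have hv : ∀ i, v i ∈ V₁ := fun i => hWV₁ (hspan ▸ Submodule.subset_span ⟨i, rfl⟩)
  have hgram : gramDet Q v ≠ 0 := (gramDet_ne_zero_iff v).2
    ⟨hli, hspan ▸ nondegenerateOn_of_hasSignature hsig⟩
  obtain ⟨u, hu⟩ := exists_isLorentzBasis hsig
  obtain ⟨c, hc⟩ := (Submodule.mem_span_range_iff_exists_fun ℝ).1 (hspan ▸ hu.mem 0)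
  have hpoly : (fun v : Fin 3 → V => Q (∑ i, c i • v i)) ∈ polyAlgebra (Fin 3 → V) :=
    (IsPolyMap.sum _ fun i => IsPolyMap.smul (const_mem_polyAlgebra _)
      (IsPolyMap.apply i)).comp_mem (quadraticForm_mem_polyAlgebra Q)
  have hpos : 0 < Q (∑ i, c i • v i) := by
    rw [hc, hu.apply_zero]
    exact one_pos
  filter_upwards [eventually_ne_zero_line (gramDet_mem_polyAlgebra Q) v' hgram,
    eventually_pos_line hpoly v' hpos] with t ht1 ht2
  have hmem : ∀ i, (v + t • (v' - v)) i ∈ V₁ := fun i =>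
    V₁.add_mem (hv i) (V₁.smul_mem _ (V₁.sub_mem (hv' i) (hv i)))
  have hsig' := hasSignature_span hV₁ hmem ht1
    ((Submodule.mem_span_range_iff_exists_fun ℝ).2 ⟨c, rfl⟩) ht2
  refine ⟨((gramDet_ne_zero_iff _).1 ht1).1, ?_, Submodule.span_le.2 ?_, hsig'⟩
  · rw [hpP, Submodule.span_singleton_le_iff_mem]
    refine Submodule.subset_span ⟨2, ?_⟩
    simp [hv2, hv'2]
  · rintro _ ⟨i, rfl⟩
    exact hmem i

theorem lineConnected_lorentzSubspaces [Module.Finite ℝ V] {P V₁ : Submodule ℝ V} {d : ℕ}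
    (hV₁ : HasSignature Q V₁ 1 d) {p : V} (hp : p ≠ 0) (hpP : P = Submodule.span ℝ {p}) :
    LineConnected 3 (lorentzSubspaces Q P V₁) := by
  intro W hW W' hW'
  have hpP' : p ∈ P := hpP ▸ Submodule.mem_span_singleton_self p
  obtain ⟨v, hv2, hli, hspan⟩ := exists_basis_of_mem_lorentzSubspaces hp hpP' hW
  obtain ⟨v', hv'2, hli', hspan'⟩ := exists_basis_of_mem_lorentzSubspaces hp hpP' hW'
  refine ⟨fun t => v + t • (v' - v), IsPolyMap.line v v', by simpa using hspan,
    by simpa using hli', by simpa using hspan', ?_⟩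
  exact eventually_span_mem_lorentzSubspaces hV₁ hpP hW hv2 hli hspan hv'2
    fun i => hW'.2.1 (hspan' ▸ Submodule.subset_span ⟨i, rfl⟩)

/-- One equation on bases for each pair of coefficient vectors expressing `x` and `y`. -/
theorem isZariskiClosedIn_pairs (X : Set (Submodule ℝ V)) {p : V × V → ℝ}
    (hp : p ∈ polyAlgebra (V × V)) :
    IsZariskiClosedIn 3 X {W | W ∈ X ∧ ∀ x ∈ W, ∀ y ∈ W, p (x, y) = 0} := by
  have hsum : ∀ c : Fin 3 → ℝ, IsPolyMap fun v : Fin 3 → V => ∑ i, c i • v i := fun c =>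
    IsPolyMap.sum _ fun i => IsPolyMap.smul (const_mem_polyAlgebra _) (IsPolyMap.apply i)
  refine ⟨fun L hL => hL.1, Set.range fun c : (Fin 3 → ℝ) × (Fin 3 → ℝ) => fun v : Fin 3 → V =>
    p (∑ i, c.1 i • v i, ∑ i, c.2 i • v i), ?_, fun v _ hv => ?_⟩
  · rintro _ ⟨c, rfl⟩
    exact ((hsum c.1).prodMk (hsum c.2)).comp_mem hp
  · simp only [Set.mem_ofPred_eq, hv, true_and, Set.forall_mem_range,
      Submodule.mem_span_range_iff_exists_fun, forall_exists_index, forall_apply_eq_imp_iff,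
      Prod.forall]

theorem aeval_toMatrix_mem_polyAlgebra {n : Type*} [Fintype n] [DecidableEq n]
    (b : Module.Basis n ℝ V) (F : MvPolynomial (n × n) ℚ) :
    (fun A : Module.End ℝ V => MvPolynomial.aeval
      (fun ij => LinearMap.toMatrix b b A ij.1 ij.2) F) ∈ polyAlgebra (Module.End ℝ V) := by
  induction F using MvPolynomial.induction_on with
  | C a =>
    simp only [MvPolynomial.aeval_C]
    exact const_mem_polyAlgebra _
  | add F G hF hG =>
    simp only [map_add]
    exact add_mem_polyAlgebra hF hG
  | mul_X F ij hF =>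
    simp only [map_mul, MvPolynomial.aeval_X]
    refine mul_mem_polyAlgebra hF ?_
    convert dual_mem_polyAlgebra (b.coord ij.1 ∘ₗ LinearMap.applyₗ (b ij.2)) using 2 with A
    exact LinearMap.toMatrix_apply b b A ij.1 ij.2

end Lines

/-! ### From a general unipotent group to `SO(V₁)` -/

section Main

variable {V : Type*} [AddCommGroup V] [Module ℝ V] [Module.Finite ℝ V] {Q : QuadraticForm ℝ V}

theorem isPolyMap_quadExp : IsPolyMap (quadExp : Module.End ℝ V → Module.End ℝ V) := by
  have h : (quadExp : Module.End ℝ V → Module.End ℝ V) =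
      fun N => 1 + N + (1 / 2 : ℝ) • (N * N) := by
    ext1 N
    rw [quadExp, pow_two]
  rw [h]
  exact ((IsPolyMap.const 1).add IsPolyMap.id).add
    (IsPolyMap.smul (const_mem_polyAlgebra _) (IsPolyMap.id.mul IsPolyMap.id))

theorem isZariskiClosedIn_quadExp (X : Set (Submodule ℝ (Module.End ℝ V)))
    {f : Module.End ℝ V → ℝ} (hf : f ∈ polyAlgebra (Module.End ℝ V)) :
    IsZariskiClosedIn 1 X {L | L ∈ X ∧ ∀ N ∈ L, f (quadExp N) = 0} := by
  refine ⟨fun L hL => hL.1, Set.range fun c : ℝ => fun v : Fin 1 → Module.End ℝ V =>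
    f (quadExp (c • v 0)), ?_, fun v _ hv => ?_⟩
  · rintro _ ⟨c, rfl⟩
    exact ((IsPolyMap.smul (const_mem_polyAlgebra c) (IsPolyMap.apply 0)).comp
      isPolyMap_quadExp).comp_mem hf
  · have hr : Set.range v = {v 0} := by
      rw [Set.range_unique]
      rfl
    rw [hr] at hv
    simp only [Set.mem_ofPred_eq, hv, true_and, Set.forall_mem_range, hr,
      Submodule.mem_span_singleton, forall_exists_index, forall_apply_eq_imp_iff]

/-- The equations `I` of `S` are not known before `W` and `L` are chosen, so genericity is imposed
for every function of the countable family `f`. -/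
theorem forGeneral_specialOrthogonal_le (hQ : NondegenerateOn Q ⊤) {P V₁ : Submodule ℝ V} {d : ℕ}
    (hV₁ : HasSignature Q V₁ 1 d) {p : V} (hp : p ≠ 0) (hpP : P = Submodule.span ℝ {p})
    (hPV₁ : P ≤ V₁) {ι : Type*} [Countable ι] {f : ι → Module.End ℝ V → ℝ}
    (hf : ∀ i, f i ∈ polyAlgebra (Module.End ℝ V)) :
    ForGeneral 3 (lorentzSubspaces Q P V₁) fun W => ForGeneral 1 (unipotentDirections Q W)
      fun L => ∀ H ≤ specialOrthogonal Q W, IsOneParameterUnipotent H L →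
        ∀ (S : Subgroup (LinearMap.GeneralLinearGroup ℝ V)) (I : Set ι),
          (∀ g, g ∈ S ↔ ∀ i ∈ I, f i (g : Module.End ℝ V) = 0) → H ≤ S →
            specialOrthogonal Q V₁ ≤ S := by
  choose r hr hrf using fun i => exists_reflection_polynomial Q (hf i)
  refine ((lineConnected_lorentzSubspaces hV₁ hp hpP).forGeneral fun i =>
    isZariskiClosedIn_pairs _ (hr i)).mono fun W hW hgenW => ?_
  obtain ⟨u, hu⟩ := exists_isLorentzBasis hW.2.2
  refine ((hu.lineConnected hQ).forGeneral fun i =>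
    isZariskiClosedIn_quadExp _ (hf i)).mono fun L hL hgenL => ?_
  intro H _ hHL S I hSI hHS
  -- Generality of `L`: equations of `S` true on `exp L` are true on the exponential of every
  -- nilpotent line.
  have hSL : ∀ L' ∈ unipotentDirections Q W, ∀ N ∈ L', ∀ g : LinearMap.GeneralLinearGroup ℝ V,
      (g : Module.End ℝ V) = quadExp N → g ∈ S := by
    intro L' hL' N hN g hg
    refine (hSI g).2 fun i hi => ?_
    rw [hg]
    refine (hgenL i ⟨hL, fun M hM => ?_⟩ hL').2 N hN
    have hM3 := pow_three_eq_zero_of_mem hu hQ hL hM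
    obtain ⟨N₀, -, -, rfl, hN₀⟩ := hHL
    obtain ⟨t, rfl⟩ := Submodule.mem_span_singleton.1 hM
    exact (hSI _).1 (hHS ((hN₀ (quadExpUnit hM3)).2
      ⟨t, (nilpotentExp_eq_quadExp hM3).symm⟩)) i hi
  have hSW : ∀ i ∈ I, ∀ x ∈ W, ∀ y ∈ W, r i (x, y) = 0 := by
    intro i hi x hx y hy
    have hfst : IsPolyMap fun z : V × V => z.1 := IsPolyMap.linear (LinearMap.fst ℝ V V)
    have hsnd : IsPolyMap fun z : V × V => z.2 := IsPolyMap.linear (LinearMap.snd ℝ V V)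
    have hQ1 := hfst.comp_mem (quadraticForm_mem_polyAlgebra Q)
    have hQ2 := hsnd.comp_mem (quadraticForm_mem_polyAlgebra Q)
    have hB := (IsPolyMap.bilinear (bil Q) hfst hsnd).mem
    -- The orthogonal pair `(u 1, u 2)` spans a negative definite plane, so `reflection_mul_mem`
    -- applies to all pairs near it on the line to `(x, y)`.
    have e1 := eventually_pos_line (x := (u 1, u 2))
      (mul_mem_polyAlgebra (const_mem_polyAlgebra (-1)) hQ1) (x, y) (by simp [hu.apply_one])
    have e2 := eventually_pos_line (x := (u 1, u 2))
      (mul_mem_polyAlgebra (const_mem_polyAlgebra (-1)) hQ2) (x, y) (by simp [hu.apply_two])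
    have e3 := eventually_pos_line (x := (u 1, u 2))
      (add_mem_polyAlgebra (mul_mem_polyAlgebra (mul_mem_polyAlgebra (const_mem_polyAlgebra 4)
        hQ1) hQ2) (mul_mem_polyAlgebra (const_mem_polyAlgebra (-1)) (pow_mem_polyAlgebra hB 2)))
      (x, y) (by rw [hu.apply_one, hu.apply_two, hu.bil_one_two]; norm_num)
    refine eq_zero_of_eventually_line (hr i) (u 1, u 2) (x, y) ?_
    filter_upwards [e1, e2, e3] with t h1 h2 h3
    refine (hrf i _ _).2 fun hx0 hy0 => ?_
    have := hu.reflection_mul_mem hSL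
      (W.add_mem (hu.mem 1) (W.smul_mem t (W.sub_mem hx (hu.mem 1))))
      (W.add_mem (hu.mem 2) (W.smul_mem t (W.sub_mem hy (hu.mem 2))))
      (by simpa using h1) (by simpa using h2) ?_ hx0 hy0
    · exact (hSI _).1 this i hi
    · have h3' := h3
      dsimp only [Prod.fst_add, Prod.snd_add, Prod.smul_fst, Prod.smul_snd, Prod.fst_sub,
        Prod.snd_sub] at h3'
      linarith
  have hpP' : p ∈ P := hpP ▸ Submodule.mem_span_singleton_self p
  obtain ⟨v, hv2, hli, hspan⟩ := exists_basis_of_mem_lorentzSubspaces hp hpP' hW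
  refine specialOrthogonal_le hQ (nondegenerateOn_of_hasSignature hV₁) S
    fun x hx y hy hx0 hy0 => (hSI _).2 fun i hi => ?_
  refine (hrf i x y).1 ?_ hx0 hy0
  have hpoly : (fun v : Fin 3 → V => r i (v 0, v 1)) ∈ polyAlgebra (Fin 3 → V) :=
    ((IsPolyMap.apply 0).prodMk (IsPolyMap.apply 1)).comp_mem (hr i)
  -- Keeping `p` as third vector keeps `P` inside the deformed subspaces; generality of `W` makes
  -- the polynomial vanish on them for small `t`.
  refine eq_zero_of_eventually_line hpoly v ![x, y, p] ?_
  filter_upwards [eventually_span_mem_lorentzSubspaces hV₁ hpP hW hv2 hli hspan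
    (v' := ![x, y, p]) rfl (by
      intro j
      fin_cases j
      exacts [hx, hy, hPV₁ hpP'])] with t ht
  exact (hgenW i ⟨hW, hSW i hi⟩ ht.2).2 _ (Submodule.subset_span ⟨0, rfl⟩) _
    (Submodule.subset_span ⟨1, rfl⟩)

end Main

end RationalHull

theorem mainTheorem6 {E : Type*} [AddCommGroup E] [Module ℚ E] [FiniteDimensional ℚ E]
    (d : ℕ) (hd : 2 ≤ d) (q : QuadraticForm ℚ E)
    (hq : RationalHull.HasSignature (q.baseChange ℝ) ⊤ 3 d)
    (V₁ : Submodule ℝ (ℝ ⊗[ℚ] E)) (hV₁ : RationalHull.HasSignature (q.baseChange ℝ) V₁ 1 d)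
    (P : Submodule ℝ (ℝ ⊗[ℚ] E)) (hP : Module.finrank ℝ P = 1) (hPV₁ : P ≤ V₁) :
    RationalHull.ForGeneral 3
      {W | P ≤ W ∧ W ≤ V₁ ∧ RationalHull.HasSignature (q.baseChange ℝ) W 1 2}
      fun W => RationalHull.ForGeneral 1
        (RationalHull.unipotentDirections (q.baseChange ℝ) W)
        fun L => ∀ H₀ ≤ RationalHull.specialOrthogonal (q.baseChange ℝ) W,
          RationalHull.IsOneParameterUnipotent H₀ L →
            RationalHull.specialOrthogonalPlus (q.baseChange ℝ) V₁ ⊆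
              RationalHull.rationalHull H₀ := by
  obtain ⟨⟨p, hpP⟩, hp0, hspan⟩ := finrank_eq_one_iff'.1 hP
  have hp : p ≠ 0 := fun h => hp0 (Subtype.ext h)
  have hPspan : P = Submodule.span ℝ {p} := by
    refine le_antisymm (fun w hw => ?_) (by rwa [Submodule.span_singleton_le_iff_mem])
    obtain ⟨c, hc⟩ := hspan ⟨w, hw⟩
    exact Submodule.mem_span_singleton.2 ⟨c, congrArg Subtype.val hc⟩
  let b := (Module.finBasis ℚ E).baseChange ℝ
  let f : RationalHull.RationalPolynomial E → Module.End ℝ (ℝ ⊗[ℚ] E) → ℝ := fun F A =>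
    MvPolynomial.aeval (fun ij => LinearMap.toMatrix b b A ij.1 ij.2) F
  have hf : ∀ F, f F ∈ RationalHull.polyAlgebra (Module.End ℝ (ℝ ⊗[ℚ] E)) :=
    RationalHull.aeval_toMatrix_mem_polyAlgebra b
  -- The only place where the coefficients being rational matters.
  have hcount : Countable (RationalHull.RationalPolynomial E) := by
    rw [← Cardinal.mk_le_aleph0_iff]
    exact MvPolynomial.cardinalMk_le_max.trans
      (max_le (max_le Cardinal.mk_le_aleph0 Cardinal.mk_le_aleph0) le_rfl)
  refine (RationalHull.forGeneral_specialOrthogonal_le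
    (RationalHull.nondegenerateOn_of_hasSignature hq) hV₁ hp hPspan hPV₁ hf).mono
    fun W _ hW => hW.mono fun L _ hL H₀ hH₀ hH₀L g hg => ?_
  have hg' := @connectedComponentIn_subset _ (_) _ _ _ hg
  refine Subgroup.mem_sInf.2 ?_
  rintro S ⟨⟨F, -, hS⟩, hH₀S⟩
  exact hL H₀ hH₀ hH₀L S F (fun g => Set.ext_iff.1 hS g) hH₀S hg'
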